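/- Let $n\ge 0$ be an integer and $[n]=\{1,\dots,n\}$. For a finite poset $S$ and $k\ge 0$ let $c_k(S)$ be the maximal cardinality of a union of $k$ chains (totally ordered subsets, possibly empty) of $S$. The shape $\lambda(S)$ is the diagram whose $k$-th row has $\lambda_k(S)=c_k(S)-c_{k-1}(S)$ boxes, $k\ge 1$. The standard Young tableau associated with a linear extension $\varphi:S\to[|S|]$ (an order-preserving bijection) is the tableau $T$ defined by the condition that, for every $k\geq 0$, the boxes of $T$ with entries $1,\dots,k$ form the shape $\lambda(\varphi^{-1}(\{1,\dots,k\}))$. For a permutation $\sigma$ of $[n]$, let $P_\sigma$ be the set of points $(i,\sigma(i))$, $i\in[n]$, ordered by $(i,\sigma(i))\le(j,\sigma(j))$ if and only if $i\le j$ and $\sigma(i)\le\sigma(j)$. Let $P(\sigma)$ and $Q(\sigma)$ be the standard Young tableaux associated with the linear extensions $(i,\sigma(i))\mapsto\sigma(i)$ and $(i,\sigma(i))\mapsto i$ of $P_\sigma$, respectively. Then $P(\sigma)$ and $Q(\sigma)$ are well defined (for each $\sigma$, exactly one pair of standard Young tableaux of the same shape with $n$ boxes satisfies these conditions), and the map $\sigma\mapsto(P(\sigma),Q(\sigma))$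 is a bijection from the set of permutations of $[n]$ onto the set of pairs of standard Young tableaux of the same shape consisting of $n$ boxes. -/

import Mathlib

/-! ## Greene's shape of a finite poset -/

section GreeneShape

variable {α : Type*} [PartialOrder α]

open scoped Classical in
/-- `maxChainUnion S k` is the number `c_k` of the finite poset `S` (with the order induced from
`α`): the maximal cardinality of a subset of `S` that is a union of `k` chains
(chains may be empty and may overlap). -/
noncomputable def maxChainUnion (S : Finset α) (k : ℕ) : ℕ :=
  (S.powerset.filter fun U =>
    ∃ C : Fin k → Finset α,
      (∀ i, IsChain (· ≤ ·) (C i : Set α)) ∧ U = Finset.univ.biUnion C).sup Finset.card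

/-- `greeneRow S i` is the length of row `i` of the shape `λ(S)`, with rows counted from `0`:
the number `λ_{i+1} = c_{i+1} - c_i`. The sequence `c` is weakly increasing, so the subtraction
is not truncated. -/
noncomputable def greeneRow (S : Finset α) (i : ℕ) : ℕ :=
  maxChainUnion S (i + 1) - maxChainUnion S i

/-- The set of boxes `(row, column)`, both counted from `0`, of the shape `λ(S)`. -/
def greeneShape (S : Finset α) : Set (ℕ × ℕ) :=
  {c | c.2 < greeneRow S c.1}

end GreeneShape

/-! ## Standard Young tableaux -/

/-- A standard Young tableau of shape `μ`: a filling of the boxes of `μ` by the numbers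
`1, …, |μ|`, each used once, whose entries increase along rows and down columns.
(Semistandard fillings are weakly increasing along rows; with distinct entries, strictly.
As for semistandard tableaux, `entry` is `0` outside `μ`.) -/
structure StandardYoungTableau (μ : YoungDiagram) extends SemistandardYoungTableau μ where
  bijOn' : Set.BijOn (fun c : ℕ × ℕ => entry c.1 c.2) {c | c ∈ μ} (Set.Icc 1 μ.card)

/-- A pair `(P, Q)` of standard Young tableaux of the same shape consisting of `n` boxes. -/
structure StandardYoungTableauPair (n : ℕ) where
  shape : YoungDiagram
  card_shape : shape.card = n
  P : StandardYoungTableau shape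
  Q : StandardYoungTableau shape

/-! ## The tableau of a linear extension -/

/-- A linear extension of a poset with `n` elements: an order-preserving bijection onto `[n]`.
The set `[n] = {1, …, n}` is represented by `Fin n = {0, …, n - 1}`, that is, `i` by `i - 1`. -/
structure PosetLinearExtension (α : Type*) [PartialOrder α] (n : ℕ) where
  toFun : α → Fin n
  bijective : Function.Bijective toFun
  monotone : Monotone toFun

/-- The order ideal `φ⁻¹({1, …, k})` of the first `k` elements in the order given by `φ`. -/
def PosetLinearExtension.firstElements {α : Type*} [PartialOrder α] [Fintype α] {n : ℕ}
    (φ : PosetLinearExtension α n) (k : ℕ) : Finset α :=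
  Finset.univ.filter fun p => (φ.toFun p : ℕ) < k

/-- `T` is the standard tableau associated with the linear extension `φ`: for every `k`, the boxes
with entries `1, …, k` form the shape of the order ideal `φ⁻¹({1, …, k})`. -/
def IsTableauOfLinearExtension {α : Type*} [PartialOrder α] [Fintype α] {n : ℕ}
    (φ : PosetLinearExtension α n) {μ : YoungDiagram} (T : StandardYoungTableau μ) : Prop :=
  ∀ k : ℕ, {c : ℕ × ℕ | c ∈ μ ∧ T.entry c.1 c.2 ≤ k} = greeneShape (φ.firstElements k)

/-! ## Permutation posets and their two tableaux -/

/-- The permutation poset of `σ`: the points `(i, σ i)` with the order induced from the product of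
chains `[n] × [n]`. -/
abbrev PermutationPoset {n : ℕ} (σ : Equiv.Perm (Fin n)) : Type :=
  {p : Fin n × Fin n // p.2 = σ p.1}

/-- The points `(i, σ i)` ordered by the second coordinate. -/
def linearExtensionByValue {n : ℕ} (σ : Equiv.Perm (Fin n)) :
    PosetLinearExtension (PermutationPoset σ) n where
  toFun p := p.1.2
  bijective := by
    refine ⟨?_, fun j => ⟨⟨(σ.symm j, j), by simp⟩, rfl⟩⟩
    rintro ⟨⟨a, b⟩, h⟩ ⟨⟨a', b'⟩, h'⟩ (hb : b = b')
    subst hb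
    have : a = a' := σ.injective (h.symm.trans h')
    subst this
    rfl
  monotone := fun _ _ h => h.2

/-- The points `(i, σ i)` ordered by the first coordinate. -/
def linearExtensionByPosition {n : ℕ} (σ : Equiv.Perm (Fin n)) :
    PosetLinearExtension (PermutationPoset σ) n where
  toFun p := p.1.1
  bijective := by
    refine ⟨?_, fun i => ⟨⟨(i, σ i), rfl⟩, rfl⟩⟩
    rintro ⟨⟨a, b⟩, h⟩ ⟨⟨a', b'⟩, h'⟩ (ha : a = a')
    subst ha
    have : b = b' := h.trans h'.symm
    subst this
    rfl
  monotone := fun _ _ h => h.1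

/-- `(P, Q) = (P(σ), Q(σ))`: the tableaux `P` and `Q` are those associated with the linear
extensions of the permutation poset of `σ` by value and by position, respectively. -/
def IsRobinsonSchenstedPair {n : ℕ} (σ : Equiv.Perm (Fin n))
    (T : StandardYoungTableauPair n) : Prop :=
  IsTableauOfLinearExtension (linearExtensionByValue σ) T.P ∧
    IsTableauOfLinearExtension (linearExtensionByPosition σ) T.Q

/-! A chain of the permutation poset is an increasing subword of the word of the permutation, so
`c_k` is the largest number of letters that can be coloured by `k` colours with increasing colour
classes (`le_maxChainUnion_iff_hasChainCover`). These numbers are invariant under Knuth equivalence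
(`KnuthEquiv.hasChainCover_iff`), and for the reading word of a tableau `c_k` is the total length of
the first `k` rows (`ColumnStrict.hasChainCover_iff`). Row insertion is a sequence of Knuth moves
(`RowInsertion.knuthEquiv`), so the Greene shape of a word is the shape of its insertion tableau.

The ideals by position are prefixes of the word. Their shapes are those of the successive insertion
tableaux, so `Q` is the recording tableau. The ideals by value are restrictions of the word to its
small letters. Such a restriction respects Knuth equivalence and truncates the tableau
(`greeneRow_value`), so `P` is the insertion tableau itself. Both sequences of shapes grow by one
box at a time and are therefore encoded by standard tableaux
(`IsGrowth.exists_standardYoungTableau`).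

Bijectivity is the reversibility of row insertion: `P` is the final tableau, `Q` tells which corner
to remove at each stage, and the previous tableau and inserted letter exist
(`RowInsertion.exists_of_corner`) and are unique (`RowInsertion.injective`). -/

/-! ## Words, chain covers and Knuth equivalence -/

/-- The letters of the word `w` can be coloured in such a way that each of the colours `0, …, k - 1`
forms a chain for `r` (read from left to right), and at least `m` letters receive such a colour. -/
def HasChainCover {α : Type*} (r : α → α → Prop) (w : List α) (k m : ℕ) : Prop :=
  ∃ L : List (α × ℕ), L.map Prod.fst = w ∧
    L.Pairwise (fun p q => p.2 = q.2 → p.2 < k → r p.1 q.1) ∧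
    m ≤ L.countP (fun p => decide (p.2 < k))

theorem HasChainCover.reverse {α : Type*} {r : α → α → Prop} {w : List α} {k m : ℕ}
    (h : HasChainCover r w k m) : HasChainCover (flip r) w.reverse k m := by
  obtain ⟨L, rfl, hp, hm⟩ := h
  refine ⟨L.reverse, by simp, ?_, by simpa using hm⟩
  rw [List.pairwise_reverse]
  exact hp.imp fun {a b} h e hk => h e.symm (lt_of_eq_of_lt e.symm hk)

/-- Moving `z` in front of `x` does harm only if both lie in one chain. In that case `y` takes over
the place of `z` after `x`, and `z` goes into the former chain of `y`, if there is one. -/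
theorem HasChainCover.swap_left {α : Type*} {r : α → α → Prop}
    (tr : ∀ a b c, r a b → r b c → r a c) {x y z : α} (hxy : r x y) (hyz : r y z)
    (hzy : ¬ r z y) (u v : List α) {k m : ℕ}
    (h : HasChainCover r (u ++ x :: z :: y :: v) k m) :
    HasChainCover r (u ++ z :: x :: y :: v) k m := by
  obtain ⟨L, hL, hp, hm⟩ := h
  obtain ⟨u', L1, rfl, rfl, hL1⟩ := List.map_eq_append_iff.1 hL
  obtain ⟨⟨x', c⟩, L2, rfl, rfl, hL2⟩ := List.map_eq_cons_iff.1 hL1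
  obtain ⟨⟨z', d⟩, L3, rfl, rfl, hL3⟩ := List.map_eq_cons_iff.1 hL2
  obtain ⟨⟨y', e⟩, v', rfl, rfl, rfl⟩ := List.map_eq_cons_iff.1 hL3
  clear hL hL1 hL2 hL3
  simp only [List.pairwise_append, List.pairwise_cons, List.mem_cons, forall_eq_or_imp,
    Prod.forall] at hp
  obtain ⟨hu, ⟨⟨hxz, hx_y, hxv⟩, ⟨hz_y, hzv⟩, hyv, hv⟩, huv⟩ := hp
  by_cases hcd : c = d ∧ c < k
  · obtain ⟨rfl, hc⟩ := hcd
    -- The colour of `z` cannot be that of `y`, since `z` precedes `y` without `r z y`.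
    have hce : c ≠ e := fun h => hzy (hz_y h hc)
    by_cases he : e < k
    · refine ⟨u' ++ (z', e) :: (x', c) :: (y', c) ::
        v'.map (fun p => (p.1, Equiv.swap c e p.2)), by simp, ?_, hm.trans (le_of_eq ?_)⟩
      · have hs : ∀ a, a < k → Equiv.swap c e a < k := by
          intro a ha
          rw [Equiv.swap_apply_def]; split_ifs <;> assumption
        have hs' : ∀ a, Equiv.swap c e a < k → a < k := by
          intro a ha
          simpa using hs _ ha
        simp only [List.pairwise_append, List.pairwise_cons, List.mem_cons, forall_eq_or_imp,
          Prod.forall, List.mem_map, List.pairwise_map, Prod.mk.injEq, Prod.exists]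
        refine ⟨hu, ⟨⟨fun h => absurd h.symm hce, fun h => absurd h.symm hce, ?_⟩,
          ⟨fun _ _ => hxy, ?_⟩, ?_, ?_⟩, ?_⟩
        · rintro _ _ ⟨a, b, hab, rfl, rfl⟩ h1 h2
          have : b = c := by rw [eq_comm, Equiv.swap_apply_eq_iff] at h1; simpa using h1
          exact hzv a b hab this.symm hc
        · rintro _ _ ⟨a, b, hab, rfl, rfl⟩ h1 h2
          have : b = e := by rw [eq_comm, Equiv.swap_apply_eq_iff] at h1; simpa using h1
          exact tr _ _ _ hxy (hyv a b hab this.symm he)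
        · rintro _ _ ⟨a, b, hab, rfl, rfl⟩ h1 h2
          have : b = e := by rw [eq_comm, Equiv.swap_apply_eq_iff] at h1; simpa using h1
          exact hyv a b hab this.symm he
        · exact hv.imp fun h e1 e2 => h ((Equiv.swap c e).injective e1) (hs' _ e2)
        · intro p q hpq
          obtain ⟨h1, h2, h3, h4⟩ := huv p q hpq
          refine ⟨fun e1 e2 => tr _ _ _ (h3 e1 e2) hyz, h1, fun e1 e2 => tr _ _ _ (h1 e1 e2) hxy, ?_⟩
          rintro _ _ ⟨a, b, hab, rfl, rfl⟩ e1 e2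
          rw [Equiv.swap_apply_def] at e1
          split_ifs at e1 with i1 i2
          · exact tr _ _ _ (h3 e1 e2) (tr _ _ _ hyz (hzv a b hab i1.symm hc))
          · exact tr _ _ _ (h1 e1 e2) (tr _ _ _ hxy (hyv a b hab i2.symm he))
          · exact h4 a b hab e1 e2
      · have : (fun p : α × ℕ => decide (Equiv.swap c e p.2 < k)) = fun p => decide (p.2 < k) := by
          funext p
          rw [Equiv.swap_apply_def]; split_ifs with h1 h2 <;> simp [*]
        simp [List.countP_append, List.countP_map, Function.comp_def, this, hc, he]
    -- Here `y` lies in no chain, so it replaces `z` in the chain of `x`, and `z` becomes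
    -- uncoloured.
    · refine ⟨u' ++ (z', e) :: (x', c) :: (y', c) :: v', by simp, ?_, hm.trans (le_of_eq ?_)⟩
      · simp only [List.pairwise_append, List.pairwise_cons, List.mem_cons, forall_eq_or_imp,
          Prod.forall]
        refine ⟨hu, ⟨⟨fun _ h => absurd h he, fun _ h => absurd h he, fun _ _ _ _ h => absurd h he⟩,
          ⟨fun _ _ => hxy, hxv⟩, fun a b hab h1 h2 => tr _ _ _ hyz (hzv a b hab h1 h2), hv⟩, ?_⟩
        intro p q hpq
        obtain ⟨h1, h2, h3, h4⟩ := huv p q hpq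
        exact ⟨fun e1 e2 => absurd (e1 ▸ e2) he, h1, fun e1 e2 => tr _ _ _ (h1 e1 e2) hxy, h4⟩
      · simp [List.countP_append, hc, he]
  · refine ⟨u' ++ (z', d) :: (x', c) :: (y', e) :: v', by simp, ?_, hm.trans (le_of_eq ?_)⟩
    · simp only [List.pairwise_append, List.pairwise_cons, List.mem_cons, forall_eq_or_imp,
        Prod.forall]
      refine ⟨hu, ⟨⟨fun h1 h2 => absurd ⟨h1.symm, h1 ▸ h2⟩ hcd, hz_y, hzv⟩,
        ⟨hx_y, hxv⟩, hyv, hv⟩, ?_⟩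
      intro p q hpq
      obtain ⟨h1, h2, h3, h4⟩ := huv p q hpq
      exact ⟨h2, h1, h3, h4⟩
    · simp only [List.countP_append, List.countP_cons]; omega

/-- Two adjacent letters that are not in the relation `r` never share a chain, so transposing them
keeps every colour class a chain. -/
theorem HasChainCover.swap_right {α : Type*} {r : α → α → Prop} {x z : α} (hzx : ¬ r z x)
    (u v : List α) {k m : ℕ} (h : HasChainCover r (u ++ z :: x :: v) k m) :
    HasChainCover r (u ++ x :: z :: v) k m := by
  obtain ⟨L, hL, hp, hm⟩ := h
  obtain ⟨u', L1, rfl, rfl, hL1⟩ := List.map_eq_append_iff.1 hL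
  obtain ⟨⟨z', d⟩, L2, rfl, rfl, hL2⟩ := List.map_eq_cons_iff.1 hL1
  obtain ⟨⟨x', c⟩, v', rfl, rfl, rfl⟩ := List.map_eq_cons_iff.1 hL2
  clear hL hL1 hL2
  simp only [List.pairwise_append, List.pairwise_cons, List.mem_cons, forall_eq_or_imp,
    Prod.forall] at hp
  obtain ⟨hu, ⟨⟨h_zx, hzv⟩, hxv, hv⟩, huv⟩ := hp
  refine ⟨u' ++ (x', c) :: (z', d) :: v', by simp, ?_, hm.trans (le_of_eq ?_)⟩
  · simp only [List.pairwise_append, List.pairwise_cons, List.mem_cons, forall_eq_or_imp,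
      Prod.forall]
    refine ⟨hu, ⟨⟨fun h1 h2 => absurd (h_zx h1.symm (h1 ▸ h2)) hzx, hxv⟩, hzv, hv⟩, ?_⟩
    intro p q hpq
    obtain ⟨h1, h2, h3⟩ := huv p q hpq
    exact ⟨h2, h1, h3⟩
  · simp only [List.countP_append, List.countP_cons]; omega

/-- The elementary Knuth transformations. -/
inductive KnuthStep : List ℕ → List ℕ → Prop
  | left (u v : List ℕ) {x y z : ℕ} (hxy : x < y) (hyz : y < z) :
      KnuthStep (u ++ x :: z :: y :: v) (u ++ z :: x :: y :: v)
  | right (u v : List ℕ) {x y z : ℕ} (hxy : x < y) (hyz : y < z) :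
      KnuthStep (u ++ y :: x :: z :: v) (u ++ y :: z :: x :: v)

/-- Knuth equivalence of words. -/
abbrev KnuthEquiv : List ℕ → List ℕ → Prop := Relation.EqvGen KnuthStep

theorem KnuthEquiv.refl (w : List ℕ) : KnuthEquiv w w := Relation.EqvGen.refl _

theorem KnuthStep.hasChainCover_iff {w w' : List ℕ} (h : KnuthStep w w') (k m : ℕ) :
    HasChainCover (· < ·) w k m ↔ HasChainCover (· < ·) w' k m := by
  cases h with
  | left u v hxy hyz =>
    exact ⟨.swap_left (r := (· < ·)) (fun _ _ _ => lt_trans) hxy hyz hyz.asymm u v,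
      .swap_right (hxy.trans hyz).asymm u _⟩
  | @right u v x y z hxy hyz =>
    constructor
    -- Reading backwards with the opposite order turns this move into one of the first kind, with
    -- `x` and `z` exchanging roles.
    · intro h
      have h1 := h.reverse
      simp only [List.reverse_append, List.reverse_cons, List.append_assoc,
        List.cons_append, List.nil_append] at h1
      have h2 := (HasChainCover.swap_left (r := flip (· < ·))
        (fun a b c h1 h2 => lt_trans h2 h1) hyz hxy hxy.asymm _ _ h1).reverse
      simpa [flip] using h2
    · intro h
      have h1 : HasChainCover (· < ·) ((u ++ [y]) ++ z :: x :: v) k m := by simpa using h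
      simpa using HasChainCover.swap_right (hxy.trans hyz).asymm _ _ h1

theorem KnuthEquiv.hasChainCover_iff {w w' : List ℕ} (h : KnuthEquiv w w') (k m : ℕ) :
    HasChainCover (· < ·) w k m ↔ HasChainCover (· < ·) w' k m := by
  induction h with
  | rel _ _ h => exact h.hasChainCover_iff k m
  | refl _ => exact Iff.rfl
  | symm _ _ _ ih => exact ih.symm
  | trans _ _ _ _ _ ih1 ih2 => exact ih1.trans ih2

theorem KnuthStep.perm {w w' : List ℕ} (h : KnuthStep w w') : w.Perm w' := by
  cases h with
  | left u v => exact List.Perm.append_left u (List.Perm.swap _ _ _)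
  | right u v => exact List.Perm.append_left u (List.Perm.cons _ (List.Perm.swap _ _ _))

theorem KnuthEquiv.perm {w w' : List ℕ} (h : KnuthEquiv w w') : w.Perm w' := by
  induction h with
  | rel _ _ h => exact h.perm
  | refl _ => exact List.Perm.refl _
  | symm _ _ _ ih => exact ih.symm
  | trans _ _ _ _ _ ih1 ih2 => exact ih1.trans ih2

theorem KnuthEquiv.append {w w' : List ℕ} (h : KnuthEquiv w w') (u v : List ℕ) :
    KnuthEquiv (u ++ w ++ v) (u ++ w' ++ v) := by
  induction h with
  | rel _ _ h =>
    cases h with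
    | left a b hxy hyz =>
      simpa using Relation.EqvGen.rel _ _ (KnuthStep.left (u ++ a) (b ++ v) hxy hyz)
    | right a b hxy hyz =>
      simpa using Relation.EqvGen.rel _ _ (KnuthStep.right (u ++ a) (b ++ v) hxy hyz)
  | refl _ => exact KnuthEquiv.refl _
  | symm _ _ _ ih => exact ih.symm
  | trans _ _ _ _ _ ih1 ih2 => exact ih1.trans _ _ _ ih2

/-- Knuth equivalence is preserved by the restriction to the letters up to `k`. -/
theorem KnuthEquiv.filter_le {w w' : List ℕ} (h : KnuthEquiv w w') (k : ℕ) :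
    KnuthEquiv (w.filter (· ≤ k)) (w'.filter (· ≤ k)) := by
  induction h with
  | rel _ _ h =>
    cases h with
    | @left a b x y z hxy hyz =>
      -- If the largest letter `z` survives, so do the other two; if it is deleted, the two words
      -- become equal.
      by_cases hz : z ≤ k
      · have hy : y ≤ k := by omega
        have hx : x ≤ k := by omega
        simpa [hx, hy, hz] using Relation.EqvGen.rel _ _ (KnuthStep.left _ _ hxy hyz)
      · simpa [List.filter_cons, hz] using KnuthEquiv.refl _
    | @right a b x y z hxy hyz =>
      by_cases hz : z ≤ k
      · have hy : y ≤ k := by omega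
        have hx : x ≤ k := by omega
        simpa [hx, hy, hz] using Relation.EqvGen.rel _ _ (KnuthStep.right _ _ hxy hyz)
      · simpa [List.filter_cons, hz] using KnuthEquiv.refl _
  | refl _ => exact KnuthEquiv.refl _
  | symm _ _ _ ih => exact ih.symm
  | trans _ _ _ _ _ ih1 ih2 => exact ih1.trans _ _ _ ih2

/-! ## Tableaux as lists of rows -/

/-- The reading word of a list of rows: the rows from bottom to top. -/
def readingWord {α : Type*} : List (List α) → List α
  | [] => []
  | R :: T => readingWord T ++ R

/-- The row `S` fits below the row `R`: it is not longer, and the entries increase downwards. -/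
def RowBelow {α : Type*} (r : α → α → Prop) : List α → List α → Prop
  | _, [] => True
  | [], _ :: _ => False
  | a :: R, b :: S => r a b ∧ RowBelow r R S

/-- Each row fits below the previous one. -/
def ColumnStrict {α : Type*} (r : α → α → Prop) : List (List α) → Prop
  | [] => True
  | R :: T => RowBelow r R (T.headD []) ∧ ColumnStrict r T

section RowBelow

variable {α β : Type*} {r : α → α → Prop}

@[simp] theorem rowBelow_nil (R : List α) : RowBelow r R [] := by cases R <;> trivial

@[simp] theorem rowBelow_cons_cons {a b : α} {R S : List α} :
    RowBelow r (a :: R) (b :: S) ↔ r a b ∧ RowBelow r R S := Iff.rfl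

@[simp] theorem not_rowBelow_nil_cons {b : α} {S : List α} : ¬ RowBelow r [] (b :: S) := id

theorem RowBelow.eq_nil {S : List α} (h : RowBelow r [] S) : S = [] := by
  cases S
  · rfl
  · exact absurd h not_rowBelow_nil_cons

theorem RowBelow.tail {R S : List α} (h : RowBelow r R S) : RowBelow r R.tail S.tail := by
  cases S with
  | nil => simp
  | cons b S => cases R with
    | nil => exact absurd h not_rowBelow_nil_cons
    | cons a R => exact h.2

theorem RowBelow.length_le {R S : List α} (h : RowBelow r R S) : S.length ≤ R.length := by
  induction S generalizing R with
  | nil => simp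
  | cons b S ih => cases R with
    | nil => exact absurd h not_rowBelow_nil_cons
    | cons a R => simpa using ih h.2

theorem rowBelow_map {f : β → α} {R S : List β} :
    RowBelow (fun p q => r (f p) (f q)) R S ↔ RowBelow r (R.map f) (S.map f) := by
  induction S generalizing R with
  | nil => simp
  | cons b S ih => cases R with
    | nil => simp
    | cons a R => simp [ih]

theorem columnStrict_map {f : β → α} {T : List (List β)} :
    ColumnStrict (fun p q => r (f p) (f q)) T ↔ ColumnStrict r (T.map (List.map f)) := by
  induction T with
  | nil => simp [ColumnStrict]
  | cons R T ih => cases T <;> simp_all [ColumnStrict, rowBelow_map]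

theorem ColumnStrict.map_tail {T : List (List α)} (h : ColumnStrict r T) :
    ColumnStrict r (T.map List.tail) := by
  induction T with
  | nil => trivial
  | cons R T ih =>
    refine ⟨?_, ih h.2⟩
    have := h.1.tail
    cases T <;> simp_all

theorem readingWord_map {f : β → α} (T : List (List β)) :
    readingWord (T.map (List.map f)) = (readingWord T).map f := by
  induction T with
  | nil => rfl
  | cons R T ih => simp [readingWord, ih]

/-- Turns a colouring of the letters of a reading word into a colouring of the boxes. -/
theorem exists_readingWord_eq_of_map_eq {f : β → α} {T : List (List α)} {L : List β}
    (h : L.map f = readingWord T) :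
    ∃ U : List (List β), readingWord U = L ∧ U.map (List.map f) = T := by
  induction T generalizing L with
  | nil => exact ⟨[], by simpa [readingWord, eq_comm] using h, rfl⟩
  | cons R T ih =>
    obtain ⟨L1, L2, rfl, h1, h2⟩ := List.map_eq_append_iff.1 h
    obtain ⟨U, rfl, rfl⟩ := ih h1
    exact ⟨L2 :: U, rfl, by simp [h2]⟩

theorem readingWord_filter (p : α → Bool) (T : List (List α)) :
    readingWord (T.map (List.filter p)) = (readingWord T).filter p := by
  induction T with
  | nil => rfl
  | cons R T ih => simp [readingWord, ih]

theorem mem_readingWord {T : List (List α)} {a : α} : a ∈ readingWord T ↔ ∃ R ∈ T, a ∈ R := by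
  induction T with
  | nil => simp [readingWord]
  | cons R T ih => simp [readingWord, ih, or_comm]

/-! ### Greene's theorem for reading words of tableaux -/

@[simp] theorem filterMap_head?_nil_cons (T : List (List α)) :
    ([] :: T).filterMap List.head? = T.filterMap List.head? := rfl

@[simp] theorem filterMap_head?_cons_cons (a : α) (R : List α) (T : List (List α)) :
    ((a :: R) :: T).filterMap List.head? = a :: T.filterMap List.head? := rfl

/-- Splits off the first column, whose entries are the heads of the nonempty rows. Emptied rows stay
in the list, so row indices do not shift. -/
theorem countP_readingWord (p : α → Bool) (T : List (List α)) :
    (readingWord T).countP p =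
      (T.filterMap List.head?).countP p + (readingWord (T.map List.tail)).countP p := by
  induction T with
  | nil => rfl
  | cons R T ih =>
    cases R with
    | nil => simp [readingWord, ih]
    | cons a R =>
      simp only [readingWord, List.countP_append, ih, List.map_cons,
        filterMap_head?_cons_cons, List.countP_cons, List.tail_cons]
      omega

theorem readingWord_map_tail_sublist (T : List (List α)) :
    (readingWord (T.map List.tail)).Sublist (readingWord T) := by
  induction T with
  | nil => simp [readingWord]
  | cons R T ih => exact ih.append (List.tail_sublist R)

theorem reverse_heads_sublist (T : List (List α)) :
    (T.filterMap List.head?).reverse.Sublist (readingWord T) := by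
  induction T with
  | nil => simp [readingWord]
  | cons R T ih =>
    cases R with
    | nil => simpa [readingWord] using ih
    | cons a R => simpa [readingWord] using ih.append (show [a].Sublist (a :: R) by simp)

theorem ColumnStrict.heads_eq_nil {T : List (List α)} (h : ColumnStrict r ([] :: T)) :
    T.filterMap List.head? = [] := by
  induction T with
  | nil => rfl
  | cons R T ih =>
    have hR : R = [] := h.1.eq_nil
    subst hR
    simpa using ih h.2

theorem ColumnStrict.rel_head (tr : ∀ a b c, r a b → r b c → r a c) {a : α} {R : List α}
    {T : List (List α)} (h : ColumnStrict r ((a :: R) :: T)) {b : α}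
    (hb : b ∈ T.filterMap List.head?) : r a b := by
  induction T generalizing a R with
  | nil => simp at hb
  | cons S T ih =>
    cases S with
    | nil =>
      rw [filterMap_head?_nil_cons, h.2.heads_eq_nil] at hb
      simp at hb
    | cons c S =>
      have hac : r a c := h.1.1
      simp only [filterMap_head?_cons_cons, List.mem_cons] at hb
      rcases hb with rfl | hb
      · exact hac
      · exact tr _ _ _ hac (ih h.2 hb)

theorem ColumnStrict.pairwise_heads (tr : ∀ a b c, r a b → r b c → r a c) {T : List (List α)}
    (h : ColumnStrict r T) : (T.filterMap List.head?).Pairwise r := by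
  induction T with
  | nil => simp
  | cons R T ih =>
    cases R with
    | nil => simpa using ih h.2
    | cons a R =>
      simp only [filterMap_head?_cons_cons, List.pairwise_cons]
      exact ⟨fun b hb => h.rel_head tr hb, ih h.2⟩

/-- The nonempty rows come first, so the first column meets the top `k` rows as often as its length
allows. -/
theorem ColumnStrict.min_le_length_heads_take {T : List (List α)} (h : ColumnStrict r T) (k : ℕ) :
    min k (T.filterMap List.head?).length ≤ ((T.take k).filterMap List.head?).length := by
  induction T generalizing k with
  | nil => simp
  | cons R T ih =>
    cases R with
    | nil => simp [h.heads_eq_nil]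
    | cons a R =>
      cases k with
      | zero => simp
      | succ k =>
        have := ih h.2 k
        simp only [filterMap_head?_cons_cons, List.length_cons, List.take_succ_cons]
        omega

theorem length_flatten_eq_heads_add (T : List (List α)) :
    T.flatten.length = (T.filterMap List.head?).length + (T.map List.tail).flatten.length := by
  induction T with
  | nil => rfl
  | cons R T ih => cases R with
    | nil => simp_all
    | cons a R => simp_all; omega

/-- Each column is read from bottom to top, against `r`, so it meets each chain at most once and
contains at most `k` chain letters. Summing the minimum of `k` and the column length over all
columns gives the size of the top `k` rows. The induction is on a bound `N` for the number of
columns. -/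
theorem ColumnStrict.countP_le {T : List (List (α × ℕ))} {k : ℕ}
    (asymm : ∀ a b, r a b → ¬ r b a) (tr : ∀ a b c, r a b → r b c → r a c)
    (h : ColumnStrict (fun p q => r p.1 q.1) T)
    (hc : (readingWord T).Pairwise (fun p q => p.2 = q.2 → p.2 < k → r p.1 q.1)) :
    (readingWord T).countP (fun p => decide (p.2 < k)) ≤ (T.take k).flatten.length := by
  obtain ⟨N, hN⟩ : ∃ N, ∀ R ∈ T, R.length ≤ N :=
    ⟨(T.map List.length).sum, fun R hR => List.le_sum_of_mem (List.mem_map_of_mem hR)⟩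
  induction N generalizing T with
  | zero =>
    have : readingWord T = [] := by
      rw [List.eq_nil_iff_forall_not_mem]
      intro a ha
      obtain ⟨R, hR, ha⟩ := mem_readingWord.1 ha
      have := List.length_pos_of_mem ha
      have := hN R hR
      omega
    simp [this]
  | succ N ih =>
    have h1 := ih h.map_tail (hc.sublist (readingWord_map_tail_sublist T)) (by
      simp only [List.mem_map]
      rintro _ ⟨R, hR, rfl⟩
      have := hN R hR
      simp; omega)
    rw [countP_readingWord, length_flatten_eq_heads_add]
    rw [← List.map_take] at h1
    refine add_le_add (le_trans ?_ (h.min_le_length_heads_take k)) h1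
    refine le_min ?_ List.countP_le_length
    have h2 := h.pairwise_heads (fun a b c => tr a.1 b.1 c.1)
    have h3 := hc.sublist (reverse_heads_sublist T)
    rw [List.pairwise_reverse] at h3
    set H := T.filterMap List.head?
    -- Two entries of a column with a common colour would be related both ways: downwards by column
    -- strictness, upwards by the reading order.
    have h4 : ((H.filter (fun p => decide (p.2 < k))).map Prod.snd).Nodup := by
      rw [List.Nodup, List.pairwise_map, List.pairwise_filter]
      refine (h2.and h3).imp ?_
      rintro a b ⟨hr, hab⟩ ha hb e
      exact asymm _ _ hr (hab e.symm (by simpa using hb))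
    rw [List.countP_eq_length_filter]
    have h5 := (h4.subperm (l₂ := List.range k) (by
      intro a; simp only [List.mem_map, List.mem_filter, List.mem_range]
      rintro ⟨p, ⟨_, hp⟩, rfl⟩
      simpa using hp)).length_le
    simpa using h5

/-- Colours the letters of row `i + j` of a list of rows by `i + j`. -/
def colourRows : ℕ → List (List α) → List (List (α × ℕ))
  | _, [] => []
  | i, R :: T => R.map (fun a => (a, i)) :: colourRows (i + 1) T

theorem map_colourRows (i : ℕ) (T : List (List α)) :
    (colourRows i T).map (List.map Prod.fst) = T := by
  induction T generalizing i with
  | nil => rfl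
  | cons R T ih => simp [colourRows, ih, Function.comp_def]

theorem le_of_mem_colourRows {i : ℕ} {T : List (List α)} {p : α × ℕ}
    (h : p ∈ readingWord (colourRows i T)) : i ≤ p.2 := by
  induction T generalizing i with
  | nil => simp [colourRows, readingWord] at h
  | cons R T ih =>
    simp only [colourRows, readingWord, List.mem_append, List.mem_map] at h
    rcases h with h | ⟨a, _, rfl⟩
    · have := ih h; omega
    · rfl

theorem pairwise_colourRows {T : List (List α)} (h : ∀ R ∈ T, R.Pairwise r) (i k : ℕ) :
    (readingWord (colourRows i T)).Pairwise (fun p q => p.2 = q.2 → p.2 < k → r p.1 q.1) := by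
  induction T generalizing i with
  | nil => simp [colourRows, readingWord]
  | cons R T ih =>
    simp only [colourRows, readingWord, List.pairwise_append, List.pairwise_map, List.mem_map]
    refine ⟨ih (fun S hS => h S (by simp [hS])) _, (h R (by simp)).imp fun h _ _ => h, ?_⟩
    rintro p hp _ ⟨a, _, rfl⟩ e
    have := le_of_mem_colourRows hp
    simp at e; omega

theorem length_take_le_countP_colourRows (T : List (List α)) (i k : ℕ) :
    (T.take k).flatten.length ≤
      (readingWord (colourRows i T)).countP (fun p => decide (p.2 < i + k)) := by
  induction T generalizing i k with
  | nil => simp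
  | cons R T ih =>
    cases k with
    | zero => simp
    | succ k =>
      have := ih (i + 1) k
      rw [show i + 1 + k = i + (k + 1) by omega] at this
      have h2 : (R.map (fun a => (a, i))).countP (fun p => decide (p.2 < i + (k + 1))) =
          R.length := by
        rw [List.countP_map, List.countP_eq_length.2]; simp
      simp only [colourRows, readingWord, List.countP_append, List.take_succ_cons,
        List.flatten_cons, List.length_append, h2]
      omega

/-- Greene's theorem for the reading word of a tableau. -/
theorem ColumnStrict.hasChainCover_iff {T : List (List α)}
    (asymm : ∀ a b, r a b → ¬ r b a) (tr : ∀ a b c, r a b → r b c → r a c)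
    (h : ColumnStrict r T) (hrow : ∀ R ∈ T, R.Pairwise r) (k m : ℕ) :
    HasChainCover r (readingWord T) k m ↔ m ≤ (T.take k).flatten.length := by
  constructor
  · rintro ⟨L, hL, hp, hm⟩
    obtain ⟨U, rfl, rfl⟩ := exists_readingWord_eq_of_map_eq hL
    refine hm.trans (((columnStrict_map.2 h).countP_le asymm tr hp).trans (le_of_eq ?_))
    rw [← List.map_take, ← List.map_flatten, List.length_map]
  · intro hm
    refine ⟨readingWord (colourRows 0 T), ?_, pairwise_colourRows hrow 0 k, hm.trans ?_⟩
    · rw [← readingWord_map, map_colourRows]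
    · simpa using length_take_le_countP_colourRows T 0 k

end RowBelow

/-! ## Row insertion -/

/-- `RowInsertion T a U`: the row insertion of the letter `a` into the rows `T` produces `U`. -/
inductive RowInsertion : List (List ℕ) → ℕ → List (List ℕ) → Prop
  | nil (a : ℕ) : RowInsertion [] a [[a]]
  | append {R : List ℕ} (T : List (List ℕ)) {a : ℕ} (h : ∀ x ∈ R, x < a) :
      RowInsertion (R :: T) a ((R ++ [a]) :: T)
  | bump {A : List ℕ} (B : List ℕ) {a b : ℕ} {T U : List (List ℕ)} (h : ∀ x ∈ A, x < a)
      (hab : a < b) (hT : RowInsertion T b U) :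
      RowInsertion ((A ++ b :: B) :: T) a ((A ++ a :: B) :: U)

/-- A list of nonempty rows that form a tableau. -/
structure IsRowTableau (T : List (List ℕ)) : Prop where
  row_lt : ∀ R ∈ T, R.Pairwise (· < ·)
  col : ColumnStrict (· < ·) T
  ne_nil : ∀ R ∈ T, R ≠ []

theorem IsRowTableau.nil : IsRowTableau [] := ⟨by simp, trivial, by simp⟩

theorem IsRowTableau.of_cons {R : List ℕ} {T : List (List ℕ)} (h : IsRowTableau (R :: T)) :
    IsRowTableau T :=
  ⟨fun S hS => h.row_lt S (by simp [hS]), h.col.2, fun S hS => h.ne_nil S (by simp [hS])⟩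

/-! ### Adjacent rows under bumping and reverse bumping -/

section RowBelowLemmas

theorem RowBelow.append_right {α : Type*} {r : α → α → Prop} {R S : List α} (h : RowBelow r R S)
    (X : List α) : RowBelow r (R ++ X) S := by
  induction S generalizing R with
  | nil => simp
  | cons b S ih => cases R with
    | nil => exact absurd h not_rowBelow_nil_cons
    | cons a R => exact ⟨h.1, ih h.2⟩

theorem RowBelow.of_append_right {α : Type*} {r : α → α → Prop} {R S X : List α}
    (h : RowBelow r (R ++ X) S) (hl : S.length ≤ R.length) : RowBelow r R S := by
  induction S generalizing R with
  | nil => simp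
  | cons b S ih => cases R with
    | nil => simp at hl
    | cons a R => exact ⟨h.1, ih h.2 (by simpa using hl)⟩

theorem RowBelow.replace_lt {a b : ℕ} (hab : a < b) {A B S : List ℕ}
    (h : RowBelow (· < ·) (A ++ b :: B) S) : RowBelow (· < ·) (A ++ a :: B) S := by
  induction S generalizing A with
  | nil => simp
  | cons s S ih => cases A with
    | nil => exact ⟨hab.trans h.1, h.2⟩
    | cons x A => exact ⟨h.1, ih h.2⟩

theorem RowBelow.replace_of_forall_lt {a b : ℕ} {A B S : List ℕ}
    (h : RowBelow (· < ·) (A ++ a :: B) S) (hS : ∀ s ∈ S, b < s) :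
    RowBelow (· < ·) (A ++ b :: B) S := by
  induction S generalizing A with
  | nil => simp
  | cons s S ih => cases A with
    | nil => exact ⟨hS s (by simp), h.2⟩
    | cons x A => exact ⟨h.1, ih h.2 fun s hs => hS s (by simp [hs])⟩

/-- A bumped letter never moves to the right: an entry of `A'` below `b` or further right would
exceed `b`. So `b` lands under `a` or under an entry of `A`, both smaller than `b`. -/
theorem RowBelow.bump {a b : ℕ} (hab : a < b) {A B A' C : List ℕ} (hA : ∀ x ∈ A, x < a)
    (hA' : ∀ x ∈ A', x < b) (h : RowBelow (· < ·) (A ++ b :: B) (A' ++ C)) :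
    RowBelow (· < ·) (A ++ a :: B) (A' ++ b :: C.tail) := by
  induction A' generalizing A with
  | nil =>
    have ht := (h.replace_lt hab).tail
    cases A with
    | nil => exact ⟨hab, ht⟩
    | cons x A => exact ⟨(hA x (by simp)).trans hab, ht⟩
  | cons y A' ih => cases A with
    | nil => exact absurd h.1 (hA' y (by simp)).asymm
    | cons x A =>
      exact ⟨h.1, ih (fun x hx => hA x (by simp [hx])) (fun x hx => hA' x (by simp [hx])) h.2⟩

theorem RowBelow.exists_lt {b : ℕ} {R A' C : List ℕ} (hA' : ∀ x ∈ A', x < b)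
    (h : RowBelow (· < ·) R (A' ++ b :: C)) : ∃ x ∈ R, x < b := by
  cases R with
  | nil => cases A' <;> exact absurd h not_rowBelow_nil_cons
  | cons x R =>
    refine ⟨x, by simp, ?_⟩
    cases A' with
    | nil => exact h.1
    | cons y A' => exact lt_trans h.1 (hA' y (by simp))

/-- On its way back up `b` never moves to the left: the entry above `b` is smaller than `b`, so it
is not in `B`. -/
theorem RowBelow.unbump {a b : ℕ} {A B A' C : List ℕ} (hA : ∀ x ∈ A, x < b)
    (hB : ∀ x ∈ B, b < x) (hA' : ∀ x ∈ A', x < b) (hC : ∀ x ∈ C, b < x)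
    (h : RowBelow (· < ·) (A ++ a :: B) (A' ++ b :: C.tail)) :
    RowBelow (· < ·) (A ++ b :: B) (A' ++ C) := by
  induction A' generalizing A with
  | nil => cases C with
    | nil => simp
    | cons c C => cases A with
      | nil => exact ⟨hC c (by simp), h.2⟩
      | cons x A =>
        exact ⟨(hA x (by simp)).trans (hC c (by simp)),
          h.2.replace_of_forall_lt fun s hs => hC s (List.mem_cons_of_mem _ hs)⟩
  | cons y A' ih => cases A with
    | nil =>
      obtain ⟨x, hx, hxb⟩ := h.2.exists_lt fun x hx => hA' x (by simp [hx])
      exact absurd hxb (hB x hx).asymm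
    | cons x A =>
      exact ⟨h.1, ih (fun x hx => hA x (by simp [hx])) (fun x hx => hA' x (by simp [hx])) h.2⟩

end RowBelowLemmas

theorem List.exists_split_first_gt {R : List ℕ} {a : ℕ} (haR : a ∉ R)
    (h : ∃ x ∈ R, a < x) : ∃ A b B, R = A ++ b :: B ∧ (∀ x ∈ A, x < a) ∧ a < b := by
  induction R with
  | nil => simp at h
  | cons x R ih =>
    by_cases hx : a < x
    · exact ⟨[], x, R, rfl, by simp, hx⟩
    · have hxa : x < a := lt_of_le_of_ne (not_lt.1 hx) fun e => haR (by simp [e])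
      obtain ⟨y, hy, hay⟩ := h
      have hyR : y ∈ R := by
        rcases List.mem_cons.1 hy with rfl | hy
        · exact absurd hay hx
        · exact hy
      obtain ⟨A, b, B, rfl, hA, hb⟩ := ih (fun h => haR (by simp [h])) ⟨y, hyR, hay⟩
      exact ⟨x :: A, b, B, rfl, by simpa [hxa] using hA, hb⟩

theorem List.Pairwise.exists_split_last_lt {R : List ℕ} {b : ℕ} (hR : R.Pairwise (· < ·))
    (hbR : b ∉ R) (h : ∃ x ∈ R, x < b) :
    ∃ A a B, R = A ++ a :: B ∧ (∀ x ∈ A, x < a) ∧ a < b ∧ ∀ x ∈ B, b < x := by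
  induction R with
  | nil => simp at h
  | cons x R ih =>
    rw [List.pairwise_cons] at hR
    by_cases h' : ∃ y ∈ R, y < b
    · obtain ⟨A, a, B, rfl, hA, hab, hB⟩ := ih hR.2 (fun h => hbR (by simp [h])) h'
      exact ⟨x :: A, a, B, rfl, by simpa [hR.1 a (by simp)] using hA, hab, hB⟩
    · push Not at h'
      obtain ⟨y, hy, hyb⟩ := h
      rcases List.mem_cons.1 hy with rfl | hy
      · exact ⟨[], y, R, rfl, by simp, hyb, fun z hz =>
          lt_of_le_of_ne (h' z hz) fun e => hbR (by simp [e, hz])⟩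
      · exact absurd hyb (h' y hy).not_gt

namespace RowInsertion

variable {T U : List (List ℕ)} {a : ℕ}

/-- One description of the first row for all three cases, where an empty `C` means that `a` is
appended. It is all that the row above needs to know to keep the columns increasing. -/
theorem headD_eq (h : RowInsertion T a U) : ∃ A C, T.headD [] = A ++ C ∧ (∀ x ∈ A, x < a) ∧
    U.headD [] = A ++ a :: C.tail ∧ ∀ c ∈ C.head?, a < c := by
  cases h with
  | nil => exact ⟨[], [], by simp⟩
  | @append R T a h => exact ⟨R, [], by simpa using h⟩
  | @bump A B a b T U h hab hT => exact ⟨A, b :: B, by simpa [hab] using h⟩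

theorem isRowTableau (h : RowInsertion T a U) (hT : IsRowTableau T) : IsRowTableau U := by
  induction h with
  | nil a => exact ⟨by simp, ⟨by simp, trivial⟩, by simp⟩
  | @append R T a h =>
    refine ⟨?_, ⟨hT.col.1.append_right _, hT.col.2⟩, ?_⟩
    · rintro S hS
      rcases List.mem_cons.1 hS with rfl | hS
      · rw [List.pairwise_append]
        exact ⟨hT.row_lt R (by simp), by simp, by simpa using h⟩
      · exact hT.row_lt S (by simp [hS])
    · rintro S hS
      rcases List.mem_cons.1 hS with rfl | hS
      · simp
      · exact hT.ne_nil S (by simp [hS])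
  | @bump A B a b T U h hab hTU ih =>
    have hU := ih hT.of_cons
    obtain ⟨A', C, h1, h2, h3, -⟩ := hTU.headD_eq
    refine ⟨?_, ⟨?_, hU.col⟩, ?_⟩
    · rintro S hS
      rcases List.mem_cons.1 hS with rfl | hS
      · have := hT.row_lt _ List.mem_cons_self
        rw [List.pairwise_append, List.pairwise_cons] at this ⊢
        refine ⟨this.1, ⟨fun x hx => hab.trans (this.2.1.1 x hx), this.2.1.2⟩, ?_⟩
        intro x hx y hy
        rcases List.mem_cons.1 hy with rfl | hy
        · exact h x hx
        · exact this.2.2 x hx y (by simp [hy])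
      · exact hU.row_lt S hS
    · rw [h3]
      have := hT.col.1
      rw [h1] at this
      exact this.bump hab h h2
    · rintro S hS
      rcases List.mem_cons.1 hS with rfl | hS
      · simp
      · exact hU.ne_nil S hS

/-- The new letter travels left past every entry larger than `b`; the left neighbour of that entry
is the witness for the move. -/
theorem knuthEquiv_row_right {a b : ℕ} {B : List ℕ} (hab : a < b)
    (hB : (b :: B).Pairwise (· < ·)) : KnuthEquiv (b :: B ++ [a]) (b :: a :: B) := by
  induction B generalizing b with
  | nil => exact KnuthEquiv.refl _
  | cons c B ih =>
    rw [List.pairwise_cons] at hB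
    have hbc : b < c := hB.1 c (by simp)
    have h1 := (ih (hab.trans hbc) hB.2).append [b] []
    have h2 := Relation.EqvGen.rel _ _ (KnuthStep.right [] B hab hbc)
    simp only [List.append_nil, List.singleton_append, List.nil_append] at h1 h2
    exact h1.trans _ _ _ h2.symm

/-- The bumped letter travels to the front of the row. The witness for passing `x` is the letter
that follows, either the next entry of `A` or `a`. -/
theorem knuthEquiv_row_left {a b : ℕ} {A B : List ℕ} (hab : a < b) (hA : ∀ x ∈ A, x < a)
    (hA' : A.Pairwise (· < ·)) : KnuthEquiv (A ++ b :: a :: B) (b :: (A ++ a :: B)) := by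
  induction A with
  | nil => exact KnuthEquiv.refl _
  | cons x A ih =>
    rw [List.pairwise_cons] at hA'
    have h1 := (ih (fun x hx => hA x (by simp [hx])) hA'.2).append [x] []
    simp only [List.append_nil, List.singleton_append] at h1
    refine h1.trans _ _ _ ?_
    cases A with
    | nil => exact Relation.EqvGen.rel _ _ (KnuthStep.left [] B (hA x (by simp)) hab)
    | cons y A =>
      exact Relation.EqvGen.rel _ _ (KnuthStep.left [] (A ++ a :: B) (hA'.1 y (by simp))
        ((hA y (by simp)).trans hab))

/-- Once the bumped letter has reached the front of its row, it stands right after the reading word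
of the lower rows, ready to be inserted there. -/
theorem knuthEquiv (h : RowInsertion T a U) (hT : ∀ R ∈ T, R.Pairwise (· < ·)) :
    KnuthEquiv (readingWord T ++ [a]) (readingWord U) := by
  induction h with
  | nil a => exact KnuthEquiv.refl _
  | append T h => simpa [readingWord] using KnuthEquiv.refl _
  | @bump A B a b T U h hab hTU ih =>
    have hR := hT _ List.mem_cons_self
    rw [List.pairwise_append] at hR
    have h1 := (knuthEquiv_row_right hab hR.2.1).append (readingWord T ++ A) []
    have h2 := (knuthEquiv_row_left (B := B) hab h hR.1).append (readingWord T) []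
    have h3 := (ih fun R hR => hT R (by simp [hR])).append [] (A ++ a :: B)
    simp only [readingWord, List.append_assoc, List.cons_append, List.append_nil,
      List.nil_append] at h1 h2 h3 ⊢
    exact h1.trans _ _ _ (h2.trans _ _ _ h3)

theorem length_row (h : RowInsertion T a U) : ∃ r, ∀ i,
    (U.getD i []).length = (T.getD i []).length + if i = r then 1 else 0 := by
  induction h with
  | nil a => exact ⟨0, fun i => by cases i <;> simp⟩
  | append T h => exact ⟨0, fun i => by cases i <;> simp⟩
  | bump B h hab hT ih =>
    obtain ⟨r, hr⟩ := ih
    exact ⟨r + 1, fun i => by cases i <;> simp_all⟩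

theorem exists_of_notMem {T : List (List ℕ)} (hT : (readingWord T).Nodup) (a : ℕ)
    (ha : a ∉ readingWord T) : ∃ U, RowInsertion T a U := by
  induction T generalizing a with
  | nil => exact ⟨_, .nil a⟩
  | cons R T ih =>
    simp only [readingWord, List.mem_append, not_or] at ha
    by_cases h : ∀ x ∈ R, x < a
    · exact ⟨_, .append T h⟩
    · have h' : ∃ x ∈ R, a < x := by
        push Not at h
        obtain ⟨x, hx, hax⟩ := h
        exact ⟨x, hx, lt_of_le_of_ne hax fun e => ha.2 (e ▸ hx)⟩
      obtain ⟨A, b, B, rfl, hA, hab⟩ := List.exists_split_first_gt ha.2 h'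
      simp only [readingWord, List.nodup_append] at hT
      obtain ⟨U, hU⟩ := ih hT.1 b fun hb => hT.2.2 b hb b (by simp) rfl
      exact ⟨_, .bump B hA hab hU⟩

theorem inv (h : RowInsertion T a U) : (T = [] ∧ U = [[a]]) ∨
    (∃ R S, T = R :: S ∧ U = (R ++ [a]) :: S) ∨
    ∃ A B b S V, T = (A ++ b :: B) :: S ∧ U = (A ++ a :: B) :: V ∧ a < b ∧
      RowInsertion S b V := by
  cases h with
  | nil => exact .inl ⟨rfl, rfl⟩
  | append T h => exact .inr (.inl ⟨_, _, rfl, rfl⟩)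
  | bump B h hab hT => exact .inr (.inr ⟨_, _, _, _, _, rfl, rfl, hab, hT⟩)

/-- The bumping letter is recovered as the last entry of the new row that is smaller than the bumped
letter `b`. -/
theorem eq_of_append_cons_eq {A B A' B' : List ℕ} {a a' b : ℕ} (h : A ++ a :: B = A' ++ a' :: B')
    (ha : a < b) (ha' : a' < b) (hB : ∀ x ∈ B, b < x) (hB' : ∀ x ∈ B', b < x) :
    A = A' ∧ a = a' ∧ B = B' := by
  rcases List.append_eq_append_iff.1 h with ⟨D, rfl, hD⟩ | ⟨D, rfl, hD⟩
  · cases D with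
    | nil => simp_all
    | cons d D =>
      simp only [List.cons_append, List.cons.injEq] at hD
      exact absurd (hB a' (by simp [hD.2])) ha'.asymm
  · cases D with
    | nil => simp_all
    | cons d D =>
      simp only [List.cons_append, List.cons.injEq] at hD
      exact absurd (hB' a (by simp [hD.2])) ha.asymm

/-- Row insertion is injective on the pairs (tableau of a given shape, letter). -/
theorem injective (h : RowInsertion T a U) {T' : List (List ℕ)} {a' : ℕ}
    (h' : RowInsertion T' a' U) (hl : T.map List.length = T'.map List.length)
    (hT : ∀ R ∈ T, R.Pairwise (· < ·)) (hT' : ∀ R ∈ T', R.Pairwise (· < ·)) :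
    T = T' ∧ a = a' := by
  induction h generalizing T' a' with
  | nil a =>
    have : T' = [] := by simpa [eq_comm] using hl
    subst this
    rcases h'.inv with ⟨_, h⟩ | ⟨R, S, h, _⟩ | ⟨A, B, b, S, V, h, _⟩
    · simpa using h
    · simp at h
    · simp at h
  | @append R T a h =>
    rcases h'.inv with ⟨rfl, _⟩ | ⟨R', S, rfl, e⟩ | ⟨A, B, b, S, V, rfl, e, -⟩
    · simp at hl
    · simp only [List.cons.injEq] at e
      have := List.append_inj_left' e.1 rfl
      subst this
      simp_all
    -- An append lengthens the first row and a bump does not, so `hl` excludes the mixed cases.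
    · simp only [List.cons.injEq, List.map_cons] at e hl
      have := congrArg List.length e.1
      simp at this hl
      omega
  | @bump A B a b T U h hab hTU ih =>
    rcases h'.inv with ⟨rfl, _⟩ | ⟨R', S, rfl, e⟩ | ⟨A', B', b', S, V, rfl, e, hab', hSV⟩
    · simp at hl
    · simp only [List.cons.injEq, List.map_cons] at e hl
      have := congrArg List.length e.1
      simp at this hl
      omega
    · simp only [List.cons.injEq, List.map_cons] at e hl
      obtain ⟨e, rfl⟩ := e
      -- The lower rows determine the bumped letter first; the top row then determines the letter
      -- that bumped it.
      obtain ⟨rfl, rfl⟩ := ih hSV hl.2 (fun R hR => hT R (by simp [hR]))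
        (fun R hR => hT' R (by simp [hR]))
      have h1 := hT _ List.mem_cons_self
      have h2 := hT' _ List.mem_cons_self
      rw [List.pairwise_append, List.pairwise_cons] at h1 h2
      obtain ⟨rfl, rfl, rfl⟩ := eq_of_append_cons_eq e hab hab' h1.2.1.1 h2.2.1.1
      exact ⟨rfl, rfl⟩

/-- Reverse row insertion starting at a corner. -/
theorem exists_of_corner {U : List (List ℕ)} (hU : IsRowTableau U) (hnd : (readingWord U).Nodup)
    {r : ℕ} (hr : (U.getD (r + 1) []).length < (U.getD r []).length) :
    ∃ T a, RowInsertion T a U ∧ IsRowTableau T ∧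
      ∀ i, (U.getD i []).length = (T.getD i []).length + if i = r then 1 else 0 := by
  induction r generalizing U with
  | zero =>
    cases U with
    | nil => simp at hr
    | cons R' S =>
      have hne := hU.ne_nil R' (by simp)
      obtain ⟨R, a, rfl⟩ : ∃ R a, R' = R ++ [a] :=
        ⟨_, _, (List.dropLast_append_getLast hne).symm⟩
      have hrow := hU.row_lt _ List.mem_cons_self
      rw [List.pairwise_append] at hrow
      -- If the corner is the only box of its row, `hr` forces the row below to be empty, hence
      -- absent.
      by_cases hR : R = []
      · subst hR
        cases S with
        | nil => exact ⟨[], a, .nil a, .nil, fun i => by cases i <;> simp⟩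
        | cons R S =>
          have := hU.ne_nil R (by simp)
          simp at hr
          contradiction
      · refine ⟨R :: S, a, .append S fun x hx => hrow.2.2 x hx a (by simp), ⟨?_, ⟨?_, hU.col.2⟩, ?_⟩,
          fun i => by cases i <;> simp⟩
        · intro X hX
          rcases List.mem_cons.1 hX with rfl | hX
          · exact hrow.1
          · exact hU.row_lt X (by simp [hX])
        · refine hU.col.1.of_append_right ?_
          cases S with
          | nil => simp
          | cons R S => simp at hr ⊢; omega
        · intro X hX
          rcases List.mem_cons.1 hX with rfl | hX
          · exact hR
          · exact hU.ne_nil X (by simp [hX])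
  | succ r ih =>
    cases U with
    | nil => simp at hr
    | cons R' V =>
      simp only [readingWord, List.nodup_append] at hnd
      obtain ⟨S, b, hSV, hS, hlen⟩ := ih hU.of_cons hnd.1 (by simpa using hr)
      obtain ⟨A', C, h1, h2, h3, h4⟩ := hSV.headD_eq
      have hcol := hU.col.1
      rw [h3] at hcol
      have hbV : b ∈ readingWord V := by
        cases V with
        | nil => simp at h3
        | cons X V =>
          simp only [List.headD_cons] at h3
          simp [readingWord, h3]
      have hrow := hU.row_lt _ List.mem_cons_self
      -- The letter `b` expelled from the lower rows replaces the last smaller entry `a`, which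
      -- exists because the first entry of this row is already smaller than `b`.
      obtain ⟨A, a, B, rfl, hA, hab, hB⟩ := hrow.exists_split_last_lt
        (fun h => hnd.2.2 b hbV b h rfl) (hcol.exists_lt h2)
      rw [List.pairwise_append, List.pairwise_cons] at hrow
      refine ⟨(A ++ b :: B) :: S, a, .bump B hA hab hSV, ⟨?_, ⟨?_, hS.col⟩, ?_⟩,
        fun i => by cases i <;> simp_all⟩
      · intro X hX
        rcases List.mem_cons.1 hX with rfl | hX
        · rw [List.pairwise_append, List.pairwise_cons]
          refine ⟨hrow.1, ⟨hB, hrow.2.1.2⟩, ?_⟩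
          intro x hx y hy
          rcases List.mem_cons.1 hy with rfl | hy
          · exact (hA x hx).trans hab
          · exact hrow.2.2 x hx y (by simp [hy])
        · exact hS.row_lt X hX
      · rw [h1]
        refine hcol.unbump (fun x hx => (hA x hx).trans hab) hB h2 ?_
        have hAC : (A' ++ C).Pairwise (· < ·) := by
          rw [← h1]
          cases S with
          | nil => simp
          | cons X S => exact hS.row_lt _ List.mem_cons_self
        cases C with
        | nil => simp
        | cons c C =>
          have hbc : b < c := h4 c rfl
          rw [List.pairwise_append, List.pairwise_cons] at hAC
          intro x hx
          rcases List.mem_cons.1 hx with rfl | hx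
          · exact hbc
          · exact hbc.trans (hAC.2.1.1 x hx)
      · intro X hX
        rcases List.mem_cons.1 hX with rfl | hX
        · simp
        · exact hS.ne_nil X hX

end RowInsertion

/-! ## Greene's shape in terms of words -/

section GreeneWord

variable {α : Type*} [PartialOrder α]

open scoped Classical in
theorem le_maxChainUnion_iff (S : Finset α) (k m : ℕ) :
    m ≤ maxChainUnion S k ↔ ∃ C : Fin k → Finset α,
      (∀ i, IsChain (· ≤ ·) (C i : Set α)) ∧ (∀ i, C i ⊆ S) ∧
        m ≤ (Finset.univ.biUnion C).card := by
  unfold maxChainUnion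
  constructor
  · intro h
    obtain ⟨U, hU, hU'⟩ := Finset.exists_mem_eq_sup (S.powerset.filter fun U =>
      ∃ C : Fin k → Finset α, (∀ i, IsChain (· ≤ ·) (C i : Set α)) ∧ U = Finset.univ.biUnion C)
      ⟨∅, by
        simp only [Finset.mem_filter, Finset.mem_powerset, Finset.empty_subset, true_and]
        exact ⟨fun _ => ∅, by simp, by ext; simp⟩⟩ Finset.card
    rw [hU'] at h
    simp only [Finset.mem_filter, Finset.mem_powerset] at hU
    obtain ⟨hUS, C, hC, rfl⟩ := hU
    exact ⟨C, hC, fun i => (Finset.subset_biUnion_of_mem C (Finset.mem_univ i)).trans hUS, h⟩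
  · rintro ⟨C, hC, hCS, hm⟩
    refine hm.trans (Finset.le_sup (f := Finset.card) ?_)
    simp only [Finset.mem_filter, Finset.mem_powerset, Finset.biUnion_subset]
    exact ⟨fun i _ => hCS i, C, hC, rfl⟩

/-- Without repetitions in `l`, a colour attached to a position is a function of the element there.
-/
theorem exists_colouring {β : Type*} {l : List β} (hl : l.Nodup) {v : β → ℕ} {L : List (ℕ × ℕ)}
    (hL : L.map Prod.fst = l.map v) : ∃ g : β → ℕ, L = l.map fun p => (v p, g p) := by
  classical
  induction l generalizing L with
  | nil => exact ⟨fun _ => 0, by simpa using hL⟩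
  | cons a l ih =>
    rw [List.nodup_cons] at hl
    obtain ⟨⟨x, c⟩, L', rfl, h1, h2⟩ := List.map_eq_cons_iff.1 hL
    obtain ⟨g, rfl⟩ := ih hl.2 h2
    refine ⟨Function.update g a c, ?_⟩
    simp only [List.map_cons, Function.update_self, List.cons.injEq, Prod.mk.injEq, and_true]
    refine ⟨h1, List.map_congr_left fun b hb => ?_⟩
    rw [Function.update_of_ne]
    rintro rfl
    exact hl.1 hb

/-- If the list `l` of the elements of `S` and the values `v` realise the order of `S` as a
permutation poset, then chains in `S` are increasing subwords of the word of values. -/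
theorem le_maxChainUnion_iff_hasChainCover {S : Finset α} {l : List α} (hl : l.Nodup)
    (hS : ∀ p, p ∈ S ↔ p ∈ l) {v : α → ℕ}
    (hv : l.Pairwise fun p q => ¬ q ≤ p ∧ (p ≤ q ↔ v p < v q)) (k m : ℕ) :
    m ≤ maxChainUnion S k ↔ HasChainCover (· < ·) (l.map v) k m := by
  classical
  rw [le_maxChainUnion_iff]
  constructor
  · rintro ⟨C, hC, hCS, hm⟩
    -- The chains may overlap, so each covered point selects one of its chains; the colour `k` marks
    -- the uncovered points.
    have hg : ∀ p, ∃ c : ℕ, (∀ h : c < k, p ∈ C ⟨c, h⟩) ∧ ((∃ i, p ∈ C i) → c < k) := by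
      intro p
      by_cases h : ∃ i, p ∈ C i
      · obtain ⟨i, hi⟩ := h
        exact ⟨i, fun _ => hi, fun _ => i.2⟩
      · exact ⟨k, fun h => absurd h (lt_irrefl _), fun h' => absurd h' h⟩
    choose g hg1 hg2 using hg
    refine ⟨l.map fun p => (v p, g p), by simp, ?_, hm.trans ?_⟩
    · rw [List.pairwise_map]
      refine hv.imp ?_
      rintro p q ⟨hqp, hpq⟩ e hk
      have hp := hg1 p hk
      simp only at e hk
      have hq := hg1 q (e ▸ hk)
      simp only [← e] at hq
      rcases (hC _).total hp hq with h | h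
      · exact hpq.1 h
      · exact absurd h hqp
    · rw [List.countP_map, List.countP_eq_length_filter, ← List.toFinset_card_of_nodup (hl.filter _)]
      refine Finset.card_le_card fun p hp => ?_
      simp only [Finset.mem_biUnion, Finset.mem_univ, true_and] at hp
      have hpl : p ∈ l := (hS p).1 (hCS _ hp.choose_spec)
      simp [hpl, hg2 p hp]
  · rintro ⟨L, hL, hp, hm⟩
    obtain ⟨g, rfl⟩ := exists_colouring hl hL
    refine ⟨fun i => S.filter fun p => g p = i, ?_, fun i => Finset.filter_subset _ _, hm.trans ?_⟩
    · intro i p hpi q hqi hne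
      simp only [Finset.coe_filter, Set.mem_ofPred_eq, hS] at hpi hqi
      rw [List.pairwise_map] at hp
      have h := hv.and hp
      have hsym : l.Pairwise fun a b => g a = g b → g a < k → a ≤ b ∨ b ≤ a :=
        h.imp fun ⟨⟨_, h1⟩, h2⟩ e hk => .inl (h1.2 (h2 e hk))
      -- Comparability is symmetric, so it passes from pairs in list order to arbitrary pairs of
      -- members.
      have : Std.Symm fun a b : α => g a = g b → g a < k → a ≤ b ∨ b ≤ a :=
        ⟨fun a b h e hk => (h e.symm (lt_of_eq_of_lt e.symm hk)).symm⟩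
      exact hsym.forall_of_forall (fun a _ _ _ => .inl le_rfl) hpi.1 hqi.1
        (hpi.2.trans hqi.2.symm) (hpi.2 ▸ i.2)
    · rw [List.countP_map, List.countP_eq_length_filter, ← List.toFinset_card_of_nodup (hl.filter _)]
      refine Finset.card_le_card fun p hp => ?_
      simp only [List.mem_toFinset, List.mem_filter, Function.comp_apply, decide_eq_true_eq] at hp
      simp only [Finset.mem_biUnion, Finset.mem_univ, true_and, Finset.mem_filter, hS]
      exact ⟨⟨g p, hp.2⟩, hp.1, rfl⟩

theorem greeneRow_eq_of_forall_le_iff {S : Finset α} {T : List (List ℕ)}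
    (h : ∀ k m, m ≤ maxChainUnion S k ↔ m ≤ (T.take k).flatten.length) (i : ℕ) :
    greeneRow S i = (T.getD i []).length := by
  have h' : ∀ k, maxChainUnion S k = (T.take k).flatten.length := fun k =>
    le_antisymm ((h k _).1 le_rfl) ((h k _).2 le_rfl)
  rw [greeneRow, h', h', List.take_add_one, List.flatten_append, List.length_append]
  cases hi : T[i]? <;> simp [hi]

end GreeneWord

/-! ## Words of permutations -/

section PermWord

variable {n : ℕ} (σ : Equiv.Perm (Fin n))

/-- The points of the permutation poset, ordered by position. -/
def permPoints : List (PermutationPoset σ) :=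
  (List.finRange n).map fun i => ⟨(i, σ i), rfl⟩

/-- The letter of a point: its value, counted from `1`. -/
def permLetter (p : PermutationPoset σ) : ℕ := p.1.2 + 1

/-- The word of a permutation, with letters `1, …, n`. -/
def permWord : List ℕ := (permPoints σ).map (permLetter σ)

@[simp] theorem length_permPoints : (permPoints σ).length = n := by simp [permPoints]

@[simp] theorem length_permWord : (permWord σ).length = n := by simp [permWord]

theorem permWord_eq : permWord σ = List.ofFn fun i => (σ i : ℕ) + 1 := by
  simp [permWord, permPoints, permLetter, List.ofFn_eq_map, Function.comp_def]

theorem mem_permPoints (p : PermutationPoset σ) : p ∈ permPoints σ := by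
  obtain ⟨⟨i, j⟩, h⟩ := p
  simp only [permPoints, List.mem_map, List.mem_finRange, true_and]
  exact ⟨i, by simp at h; simp [h]⟩

theorem permPoint_ext {p q : PermutationPoset σ} (h : p.1.1 = q.1.1) : p = q := by
  obtain ⟨⟨i, j⟩, hp⟩ := p
  obtain ⟨⟨i', j'⟩, hq⟩ := q
  simp only at h hp hq
  subst h hp hq
  rfl

theorem nodup_permPoints : (permPoints σ).Nodup :=
  (List.nodup_finRange n).map fun i j h => by simpa using congrArg (fun p => p.1.1) h

theorem pairwise_permPoints : (permPoints σ).Pairwise fun p q =>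
    ¬ q ≤ p ∧ (p ≤ q ↔ permLetter σ p < permLetter σ q) := by
  rw [permPoints, List.pairwise_map]
  refine (List.pairwise_lt_finRange n).imp ?_
  intro i j hij
  simp only [Subtype.mk_le_mk, Prod.mk_le_mk, permLetter]
  have hne : σ i ≠ σ j := fun h => hij.ne (σ.injective h)
  refine ⟨fun h => h.1.not_gt hij, fun h => ?_, fun h => ⟨hij.le, ?_⟩⟩
  · have := lt_of_le_of_ne h.2 hne
    simpa using this
  · simp only [add_lt_add_iff_right, Fin.val_fin_lt] at h
    exact h.le

theorem nodup_permWord : (permWord σ).Nodup := by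
  rw [permWord_eq, List.nodup_ofFn]
  intro i j h
  simpa [Fin.val_inj] using h

theorem mem_permWord {a : ℕ} : a ∈ permWord σ ↔ 1 ≤ a ∧ a ≤ n := by
  rw [permWord_eq, List.mem_ofFn]
  constructor
  · rintro ⟨i, rfl⟩
    have := (σ i).2
    omega
  · rintro ⟨h1, h2⟩
    exact ⟨σ.symm ⟨a - 1, by omega⟩, by simp; omega⟩

theorem permWord_injective : Function.Injective (permWord (n := n)) := by
  intro σ τ h
  rw [permWord_eq, permWord_eq] at h
  have := List.ofFn_injective h
  ext i
  simpa using congrFun this i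

theorem exists_permWord_eq {w : List ℕ} (hl : w.length = n) (hn : w.Nodup)
    (hw : ∀ a ∈ w, 1 ≤ a ∧ a ≤ n) : ∃ σ : Equiv.Perm (Fin n), permWord σ = w := by
  subst hl
  let f : Fin w.length → Fin w.length := fun i =>
    ⟨w[i] - 1, by have := hw w[i] (by simp); omega⟩
  have hf : Function.Injective f := by
    intro i j h
    have h1 := hw w[i] (by simp)
    have h2 := hw w[j] (by simp)
    have h3 : w[i] - 1 = w[j] - 1 := by simpa [f] using h
    have h4 : w[i] = w[j] := by omega
    exact Fin.ext ((hn.getElem_inj_iff).1 h4)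
  refine ⟨Equiv.ofBijective f (Finite.injective_iff_bijective.1 hf), ?_⟩
  rw [permWord_eq]
  conv_rhs => rw [← List.ofFn_getElem (xs := w)]
  congr 1
  funext i
  have h1 := hw w[i] (by simp)
  simp only [Equiv.ofBijective_apply, f]
  simp at h1 ⊢
  omega

theorem PosetLinearExtension.mem_firstElements {α : Type*} [PartialOrder α] [Fintype α] {n : ℕ}
    (φ : PosetLinearExtension α n) {k : ℕ} {p : α} :
    p ∈ φ.firstElements k ↔ (φ.toFun p : ℕ) < k := by
  simp [PosetLinearExtension.firstElements]

theorem le_maxChainUnion_firstElements_position (j k m : ℕ) :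
    m ≤ maxChainUnion ((linearExtensionByPosition σ).firstElements j) k ↔
      HasChainCover (· < ·) ((permWord σ).take j) k m := by
  rw [permWord, ← List.map_take]
  refine le_maxChainUnion_iff_hasChainCover ((nodup_permPoints σ).sublist (List.take_sublist _ _))
    (fun p => ?_) ((pairwise_permPoints σ).sublist (List.take_sublist _ _)) k m
  simp only [PosetLinearExtension.mem_firstElements, linearExtensionByPosition,
    List.mem_take_iff_getElem, length_permPoints]
  have hget : ∀ (i : ℕ) (h : i < (permPoints σ).length),
      ((permPoints σ)[i].1.1 : ℕ) = i := fun i h => by simp [permPoints]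
  constructor
  · intro hp
    have h1 : (p.1.1 : ℕ) < n := p.1.1.2
    exact ⟨p.1.1, by omega, permPoint_ext σ (Fin.ext (hget _ (by simp)))⟩
  · rintro ⟨i, hi, rfl⟩
    rw [hget]; omega

theorem le_maxChainUnion_firstElements_value (j k m : ℕ) :
    m ≤ maxChainUnion ((linearExtensionByValue σ).firstElements j) k ↔
      HasChainCover (· < ·) ((permWord σ).filter (· ≤ j)) k m := by
  rw [permWord, List.filter_map]
  refine le_maxChainUnion_iff_hasChainCover ((nodup_permPoints σ).sublist List.filter_sublist)
    (fun p => ?_) ((pairwise_permPoints σ).sublist List.filter_sublist) k m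
  simp only [PosetLinearExtension.mem_firstElements, linearExtensionByValue, true_and,
    List.mem_filter, mem_permPoints, Function.comp_apply, permLetter]
  -- Letters count from `1` and values from `0`, so the letter bound `v + 1 ≤ j` is by definition `v
  -- < j`.
  exact decide_eq_true_iff.symm

theorem RowBelow.filter_le {R S : List ℕ} (h : RowBelow (· < ·) R S) (hS : S.Pairwise (· < ·))
    (k : ℕ) : RowBelow (· < ·) (R.filter (· ≤ k)) (S.filter (· ≤ k)) := by
  induction S generalizing R with
  | nil => simp
  | cons b S ih =>
    rw [List.pairwise_cons] at hS
    cases R with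
    | nil => exact absurd h not_rowBelow_nil_cons
    | cons a R =>
      by_cases hb : b ≤ k
      · have hab : a < b := h.1
        have ha : a ≤ k := by omega
        simpa [ha, hb, hab] using ih h.2 hS.2
      · have : (b :: S).filter (· ≤ k) = [] := by
          rw [List.filter_eq_nil_iff]
          intro x hx
          rcases List.mem_cons.1 hx with rfl | hx
          · simpa using hb
          · have := hS.1 x hx
            simp; omega
        simp [this]

/-- Truncation may leave empty rows, so only column strictness is claimed; Greene's theorem for
reading words asks for no more than this and increasing rows. -/
theorem IsRowTableau.columnStrict_filter_le {T : List (List ℕ)} (h : IsRowTableau T) (k : ℕ) :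
    ColumnStrict (· < ·) (T.map (List.filter (· ≤ k))) := by
  induction T with
  | nil => trivial
  | cons R T ih =>
    refine ⟨?_, ih h.of_cons⟩
    cases T with
    | nil => simp
    | cons S T => exact RowBelow.filter_le h.col.1 (h.row_lt S (by simp)) k

theorem greeneRow_position {T : List (List ℕ)} (hT : IsRowTableau T) {k : ℕ}
    (h : KnuthEquiv ((permWord σ).take k) (readingWord T)) (i : ℕ) :
    greeneRow ((linearExtensionByPosition σ).firstElements k) i = (T.getD i []).length := by
  refine greeneRow_eq_of_forall_le_iff (fun j m => ?_) i
  rw [le_maxChainUnion_firstElements_position, h.hasChainCover_iff]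
  exact hT.col.hasChainCover_iff (r := (· < ·)) (fun _ _ => lt_asymm) (fun _ _ _ => lt_trans)
    hT.row_lt j m

/-- Restriction to the letters up to `k` respects Knuth equivalence and turns the reading word of
`T` into that of the truncated tableau. -/
theorem greeneRow_value {T : List (List ℕ)} (hT : IsRowTableau T)
    (h : KnuthEquiv (permWord σ) (readingWord T)) (k i : ℕ) :
    greeneRow ((linearExtensionByValue σ).firstElements k) i =
      ((T.getD i []).filter (· ≤ k)).length := by
  rw [greeneRow_eq_of_forall_le_iff (T := T.map (List.filter (· ≤ k))) (fun j m => ?_) i]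
  · simp only [List.getD_eq_getElem?_getD, List.getElem?_map]
    cases T[i]? <;> simp
  · rw [le_maxChainUnion_firstElements_value, (h.filter_le k).hasChainCover_iff,
      ← readingWord_filter]
    refine (hT.columnStrict_filter_le k).hasChainCover_iff (r := (· < ·)) (fun _ _ => lt_asymm)
      (fun _ _ _ => lt_trans) ?_ j m
    rintro _ hR
    obtain ⟨R, hRT, rfl⟩ := List.mem_map.1 hR
    exact (hT.row_lt R hRT).filter _

end PermWord

/-! ## Standard Young tableaux from growing sequences of shapes -/

/-- The row lengths `l k` of a sequence of shapes growing from the empty shape by one box at each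
of the first `n` steps. -/
structure IsGrowth (n : ℕ) (l : ℕ → ℕ → ℕ) : Prop where
  zero : ∀ i, l 0 i = 0
  antitone : ∀ k ≤ n, Antitone (l k)
  step : ∀ k < n, ∃ r, ∀ i, l (k + 1) i = l k i + if i = r then 1 else 0

theorem exists_youngDiagram {l : ℕ → ℕ} (hl : Antitone l) {N : ℕ} (hN : l N = 0) :
    ∃ μ : YoungDiagram, ∀ i j, (i, j) ∈ μ ↔ j < l i := by
  refine ⟨⟨(Finset.range N ×ˢ Finset.range (l 0)).filter fun c => c.2 < l c.1, ?_⟩, ?_⟩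
  · rintro ⟨i, j⟩ ⟨i', j'⟩ ⟨h1, h2⟩ h
    simp only [Finset.coe_filter, Finset.mem_product, Finset.mem_range, Set.mem_ofPred_eq] at h ⊢
    change i' ≤ i at h1
    change j' ≤ j at h2
    have := hl h1
    omega
  · intro i j
    rw [← YoungDiagram.mem_cells]
    simp only [Finset.mem_filter, Finset.mem_product, Finset.mem_range, and_iff_right_iff_imp]
    intro h
    have h0 := hl (Nat.zero_le i)
    refine ⟨?_, by omega⟩
    by_contra hi
    have := hl (not_lt.1 hi)
    omega

namespace IsGrowth

variable {n : ℕ} {l : ℕ → ℕ → ℕ}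

theorem mono (h : IsGrowth n l) {k k' : ℕ} (hk : k ≤ k') (hk' : k' ≤ n) (i : ℕ) :
    l k i ≤ l k' i := by
  induction k', hk using Nat.le_induction with
  | base => rfl
  | succ m hm ih =>
    obtain ⟨r, hr⟩ := h.step m hk'
    have := ih (by omega)
    rw [hr]; omega

theorem of_le (h : IsGrowth n l) {m : ℕ} (hm : m ≤ n) : IsGrowth m l :=
  ⟨h.zero, fun k hk => h.antitone k (hk.trans hm), fun k hk => h.step k (hk.trans_le hm)⟩

/-- The entry of a box is the first time at which the box belongs to the shape. -/
theorem exists_standardYoungTableau (h : IsGrowth n l) {μ : YoungDiagram}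
    (hμ : ∀ i j, (i, j) ∈ μ ↔ j < l n i) :
    μ.card = n ∧ ∃ T : StandardYoungTableau μ, ∀ k ≤ n, ∀ i j,
      ((i, j) ∈ μ ∧ T.entry i j ≤ k) ↔ j < l k i := by
  classical
  let e : ℕ → ℕ → ℕ := fun i j => if H : ∃ k, k ≤ n ∧ j < l k i then Nat.find H else 0
  have he : ∀ k ≤ n, ∀ i j, ((i, j) ∈ μ ∧ e i j ≤ k) ↔ j < l k i := by
    intro k hk i j
    rw [hμ]
    constructor
    · rintro ⟨h1, h2⟩
      have H : ∃ k, k ≤ n ∧ j < l k i := ⟨n, le_rfl, h1⟩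
      simp only [e, dif_pos H] at h2
      exact (Nat.find_spec H).2.trans_le (h.mono h2 hk i)
    · intro h1
      have H : ∃ k, k ≤ n ∧ j < l k i := ⟨k, hk, h1⟩
      simp only [e, dif_pos H]
      exact ⟨h1.trans_le (h.mono hk le_rfl i), Nat.find_min' H ⟨hk, h1⟩⟩
  have hle : ∀ i j, (i, j) ∈ μ → e i j ≤ n := fun i j hij =>
    ((he n le_rfl i j).2 ((hμ i j).1 hij)).2
  have hpos : ∀ i j, (i, j) ∈ μ → 1 ≤ e i j := by
    intro i j hij
    by_contra h0
    have := (he 0 (Nat.zero_le n) i j).1 ⟨hij, by omega⟩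
    rw [h.zero] at this
    omega
  have hstep : ∀ i j, (i, j) ∈ μ → ∀ k < n, e i j = k + 1 → j < l (k + 1) i ∧ l k i ≤ j := by
    intro i j hij k hk hek
    refine ⟨(he (k + 1) hk i j).1 ⟨hij, hek.le⟩, ?_⟩
    by_contra hlt
    have := ((he k hk.le i j).2 (not_le.1 hlt)).2
    omega
  have hinj : Set.InjOn (fun c : ℕ × ℕ => e c.1 c.2) {c | c ∈ μ} := by
    rintro ⟨i, j⟩ hij ⟨i', j'⟩ hij' (hee : e i j = e i' j')
    have h1 := hpos i j hij
    have h2 := hle i j hij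
    obtain ⟨k, hk⟩ : ∃ k, e i j = k + 1 := ⟨e i j - 1, by omega⟩
    obtain ⟨a1, a2⟩ := hstep i j hij k (by omega) hk
    obtain ⟨b1, b2⟩ := hstep i' j' hij' k (by omega) (hee ▸ hk)
    obtain ⟨r, hr⟩ := h.step k (by omega)
    rw [hr] at a1 b1
    split_ifs at a1 b1 with c1 c2
    · subst c1 c2
      simp; omega
    all_goals omega
  have hbij : Set.BijOn (fun c : ℕ × ℕ => e c.1 c.2) {c | c ∈ μ} (Set.Icc 1 n) := by
    refine ⟨fun c hc => ⟨hpos _ _ hc, hle _ _ hc⟩, hinj, ?_⟩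
    rintro a ⟨ha1, ha2⟩
    obtain ⟨k, rfl⟩ : ∃ k, a = k + 1 := ⟨a - 1, by omega⟩
    obtain ⟨r, hr⟩ := h.step k (by omega)
    -- The box added at step `k + 1` is at the end of row `r`, in column `l k r`.
    have h1 := (he (k + 1) ha2 r (l k r)).2 (by rw [hr]; simp)
    refine ⟨(r, l k r), h1.1, ?_⟩
    have h2 : ¬ e r (l k r) ≤ k := fun h3 => by
      have := (he k (by omega) r (l k r)).1 ⟨h1.1, h3⟩
      omega
    simp only
    omega
  have hcard : μ.card = n := by
    have := hbij.ncard_eq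
    rw [show {c | c ∈ μ} = (μ.cells : Set (ℕ × ℕ)) by ext; simp, Set.ncard_coe_finset,
      Set.ncard_eq_toFinset_card'] at this
    simpa using this
  refine ⟨hcard, ⟨⟨e, ?_, ?_, ?_⟩, by rw [hcard]; exact hbij⟩, he⟩
  · intro i j1 j2 hj hij
    have hk := hle i j2 hij
    have := (he _ hk i j2).1 ⟨hij, le_rfl⟩
    exact ((he _ hk i j1).2 (hj.trans this)).2
  · intro i1 i2 j hi hij
    have hk := hle i2 j hij
    have h1 := (he _ hk i2 j).1 ⟨hij, le_rfl⟩
    have h2 := (he _ hk i1 j).2 (h1.trans_le (h.antitone _ hk hi.le))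
    -- The shapes only give weak growth down a column; it is strict because entries are distinct.
    refine lt_of_le_of_ne h2.2 fun h3 => ?_
    have := hinj (show (i1, j) ∈ μ from h2.1) (show (i2, j) ∈ μ from hij) h3
    simp at this
    omega
  · intro i j hij
    have H : ¬ ∃ k, k ≤ n ∧ j < l k i := fun ⟨k, hk, hj⟩ => hij ((he k hk i j).2 hj).1
    simp [e, H]

end IsGrowth

namespace StandardYoungTableau

variable {μ : YoungDiagram}

theorem entry_mem_Icc (T : StandardYoungTableau μ) {i j : ℕ} (h : (i, j) ∈ μ) :
    T.entry i j ∈ Set.Icc 1 μ.card :=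
  T.bijOn'.mapsTo (show (i, j) ∈ {c | c ∈ μ} from h)

theorem eq_of_entry_eq {T T' : StandardYoungTableau μ} (h : ∀ i j, T.entry i j = T'.entry i j) :
    T = T' := by
  obtain ⟨S, hS⟩ := T
  obtain ⟨S', hS'⟩ := T'
  obtain rfl : S = S' := SemistandardYoungTableau.ext h
  rfl

end StandardYoungTableau

/-! ### Uniqueness of the tableau of a linear extension -/

section LinearExtension

variable {α : Type*} [PartialOrder α] [Fintype α] {n : ℕ} {φ : PosetLinearExtension α n}
  {μ : YoungDiagram}

theorem PosetLinearExtension.firstElements_of_le {k : ℕ} (hk : n ≤ k) :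
    φ.firstElements k = φ.firstElements n := by
  ext p
  have := (φ.toFun p).2
  simp only [PosetLinearExtension.mem_firstElements]
  omega

theorem isTableauOfLinearExtension_iff (hμ : μ.card = n) {T : StandardYoungTableau μ} :
    IsTableauOfLinearExtension φ T ↔
      ∀ k ≤ n, ∀ i j, ((i, j) ∈ μ ∧ T.entry i j ≤ k) ↔ j < greeneRow (φ.firstElements k) i := by
  simp only [IsTableauOfLinearExtension, Set.ext_iff, greeneShape, Prod.forall, Set.mem_ofPred_eq]
  refine ⟨fun h k _ => h k, fun h k i j => ?_⟩
  rcases le_total k n with hk | hk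
  · exact h k hk i j
  · rw [PosetLinearExtension.firstElements_of_le hk, ← h n le_rfl i j]
    refine and_congr_right fun hij => ?_
    have := (T.entry_mem_Icc hij).2
    omega

theorem IsTableauOfLinearExtension.mem_iff (hμ : μ.card = n) {T : StandardYoungTableau μ}
    (h : IsTableauOfLinearExtension φ T) (i j : ℕ) :
    (i, j) ∈ μ ↔ j < greeneRow (φ.firstElements n) i := by
  rw [← (isTableauOfLinearExtension_iff hμ).1 h n le_rfl i j, iff_self_and]
  intro hij
  exact hμ ▸ (T.entry_mem_Icc hij).2

/-- The sets of boxes with entries at most `k`, for all `k`, determine every entry. -/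
theorem IsTableauOfLinearExtension.unique {T T' : StandardYoungTableau μ}
    (h : IsTableauOfLinearExtension φ T) (h' : IsTableauOfLinearExtension φ T') : T = T' := by
  refine StandardYoungTableau.eq_of_entry_eq fun i j => ?_
  by_cases hij : (i, j) ∈ μ
  · have h1 : ∀ k, T.entry i j ≤ k ↔ T'.entry i j ≤ k := by
      intro k
      have := Set.ext_iff.1 ((h k).trans (h' k).symm) (i, j)
      simpa [hij] using this
    exact le_antisymm ((h1 _).2 le_rfl) ((h1 _).1 le_rfl)
  · rw [T.zeros' hij, T'.zeros' hij]

theorem IsTableauOfLinearExtension.greeneRow_eq {β : Type*} [PartialOrder β] [Fintype β]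
    {ψ : PosetLinearExtension β n} {T : StandardYoungTableau μ}
    (h : IsTableauOfLinearExtension φ T) (h' : IsTableauOfLinearExtension ψ T) (k i : ℕ) :
    greeneRow (φ.firstElements k) i = greeneRow (ψ.firstElements k) i := by
  have h1 : ∀ j, j < greeneRow (φ.firstElements k) i ↔ j < greeneRow (ψ.firstElements k) i :=
    fun j => Set.ext_iff.1 ((h k).symm.trans (h' k)) (i, j)
  refine le_antisymm ?_ ?_
  · by_contra hlt
    exact lt_irrefl _ ((h1 _).1 (not_le.1 hlt))
  · by_contra hlt
    exact lt_irrefl _ ((h1 _).2 (not_le.1 hlt))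

end LinearExtension

theorem IsRobinsonSchenstedPair.unique {n : ℕ} {σ : Equiv.Perm (Fin n)}
    {T T' : StandardYoungTableauPair n} (h : IsRobinsonSchenstedPair σ T)
    (h' : IsRobinsonSchenstedPair σ T') : T = T' := by
  obtain ⟨μ, hμ, P, Q⟩ := T
  obtain ⟨μ', hμ', P', Q'⟩ := T'
  obtain rfl : μ = μ' := by
    ext ⟨i, j⟩
    rw [YoungDiagram.mem_cells, YoungDiagram.mem_cells, h.1.mem_iff hμ, h'.1.mem_iff hμ']
  obtain rfl : P = P' := h.1.unique h'.1
  obtain rfl : Q = Q' := h.2.unique h'.2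
  rfl

/-! ## Insertion tableaux -/

/-- `T` is obtained by the successive row insertion of the letters of `w`. -/
inductive InsertionTableau : List ℕ → List (List ℕ) → Prop
  | nil : InsertionTableau [] []
  | snoc {w : List ℕ} {a : ℕ} {T U : List (List ℕ)} (hT : InsertionTableau w T)
      (h : RowInsertion T a U) : InsertionTableau (w ++ [a]) U

namespace InsertionTableau

variable {w : List ℕ} {T : List (List ℕ)}

theorem isRowTableau (h : InsertionTableau w T) : IsRowTableau T := by
  induction h with
  | nil => exact .nil
  | snoc _ h ih => exact h.isRowTableau ih

theorem knuthEquiv (h : InsertionTableau w T) : KnuthEquiv w (readingWord T) := by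
  induction h with
  | nil => exact .refl _
  | @snoc w a T U hT h ih =>
    have h1 := ih.append [] [a]
    simp only [List.nil_append] at h1
    exact h1.trans _ _ _ (h.knuthEquiv hT.isRowTableau.row_lt)

theorem inv_snoc {a : ℕ} {U : List (List ℕ)} (h : InsertionTableau (w ++ [a]) U) :
    ∃ T, InsertionTableau w T ∧ RowInsertion T a U := by
  generalize hv : w ++ [a] = v at h
  cases h with
  | nil => simp at hv
  | snoc hT h =>
    obtain ⟨rfl, e⟩ := List.append_inj' hv rfl
    obtain rfl : a = _ := by simpa using e
    exact ⟨_, hT, h⟩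

theorem exists_of_nodup {w : List ℕ} (hw : w.Nodup) : ∃ T, InsertionTableau w T := by
  induction w using List.reverseRecOn with
  | nil => exact ⟨_, .nil⟩
  | append_singleton w a ih =>
    rw [List.nodup_append] at hw
    obtain ⟨T, hT⟩ := ih hw.1
    have hp := hT.knuthEquiv.perm
    obtain ⟨U, hU⟩ := RowInsertion.exists_of_notMem (hp.nodup_iff.1 hw.1) a fun ha =>
      hw.2.2 a (hp.mem_iff.2 ha) a (by simp) rfl
    exact ⟨U, .snoc hT hU⟩

end InsertionTableau

/-! ### Tableaux and the lengths of their truncated rows -/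

theorem ColumnStrict.antitone_length {α : Type*} {r : α → α → Prop} {T : List (List α)}
    (h : ColumnStrict r T) : Antitone fun i => (T.getD i []).length := by
  refine antitone_nat_of_succ_le fun i => ?_
  induction T generalizing i with
  | nil => simp
  | cons R T ih =>
    cases i with
    | zero =>
      have := h.1.length_le
      cases T with
      | nil => simp
      | cons S T => simpa using this
    | succ i => simpa using ih h.2 i

/-- Since no row is empty, the row lengths padded by zeros also determine the number of rows. -/
theorem IsRowTableau.map_length_eq {T T' : List (List ℕ)} (h : IsRowTableau T)
    (h' : IsRowTableau T') (hl : ∀ i, (T.getD i []).length = (T'.getD i []).length) :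
    T.map List.length = T'.map List.length := by
  induction T generalizing T' with
  | nil =>
    cases T' with
    | nil => rfl
    | cons R' T' =>
      have := hl 0
      exact absurd (by simpa [eq_comm] using this) (h'.ne_nil R' (by simp))
  | cons R T ih =>
    cases T' with
    | nil =>
      have := hl 0
      exact absurd (by simpa using this) (h.ne_nil R (by simp))
    | cons R' T' =>
      have h0 := hl 0
      simp only [List.getD_cons_zero] at h0
      rw [List.map_cons, List.map_cons, h0, ih h.of_cons h'.of_cons fun i => by simpa using hl (i + 1)]

theorem List.filter_le_eq_nil_of_lt {R : List ℕ} {b k : ℕ} (hR : (b :: R).Pairwise (· < ·))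
    (hk : k < b) : (b :: R).filter (· ≤ k) = [] := by
  rw [List.pairwise_cons] at hR
  rw [List.filter_eq_nil_iff]
  intro x hx
  rcases List.mem_cons.1 hx with rfl | hx
  · simpa using hk
  · have := hR.1 x hx
    simp; omega

theorem List.eq_of_length_filter_le_eq {R R' : List ℕ} (hR : R.Pairwise (· < ·))
    (hR' : R'.Pairwise (· < ·))
    (h : ∀ k, (R.filter (· ≤ k)).length = (R'.filter (· ≤ k)).length) : R = R' := by
  induction R generalizing R' with
  | nil => cases R' with
    | nil => rfl
    | cons b R' => simpa using h b
  | cons a R ih => cases R' with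
    | nil => simpa using h a
    | cons b R' =>
      obtain rfl : a = b := by
        rcases lt_trichotomy a b with hab | hab | hab
        · have := h a
          rw [List.filter_le_eq_nil_of_lt hR' hab] at this
          simp at this
        · exact hab
        · have := h b
          rw [List.filter_le_eq_nil_of_lt hR hab] at this
          simp at this
      rw [ih (List.pairwise_cons.1 hR).2 (List.pairwise_cons.1 hR').2 fun k => ?_]
      have := h k
      simp only [List.filter_cons] at this
      split_ifs at this <;> simpa using this

theorem List.lt_length_filter_le_iff {R : List ℕ} (hR : R.Pairwise (· < ·)) (k j : ℕ) :
    j < (R.filter (· ≤ k)).length ↔ ∃ h : j < R.length, R[j] ≤ k := by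
  induction R generalizing j with
  | nil => simp
  | cons a R ih =>
    by_cases ha : a ≤ k
    · cases j with
      | zero => simp [ha]
      | succ j => simpa [ha] using ih (List.pairwise_cons.1 hR).2 j
    · rw [List.filter_le_eq_nil_of_lt hR (not_le.1 ha)]
      simp only [List.length_nil, not_lt_zero, false_iff, not_exists, not_le]
      intro h
      refine (not_le.1 ha).trans_le ?_
      rcases List.mem_cons.1 (List.getElem_mem h) with h1 | h1
      · exact h1.ge
      · exact ((List.pairwise_cons.1 hR).1 _ h1).le

theorem IsRowTableau.eq_of_length_filter_le_eq {T T' : List (List ℕ)} (h : IsRowTableau T)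
    (h' : IsRowTableau T') (hl : ∀ k i, ((T.getD i []).filter (· ≤ k)).length =
      ((T'.getD i []).filter (· ≤ k)).length) : T = T' := by
  have hrow : ∀ {T : List (List ℕ)}, IsRowTableau T → ∀ i, (T.getD i []).Pairwise (· < ·) := by
    intro T h i
    rw [List.getD_eq_getElem?_getD]
    cases hi : T[i]? with
    | none => simp
    | some R => exact h.row_lt R (List.mem_of_getElem? hi)
  have hget : ∀ i, T.getD i [] = T'.getD i [] := fun i =>
    List.eq_of_length_filter_le_eq (hrow h i) (hrow h' i) fun k => hl k i
  have hlen := congrArg List.length (h.map_length_eq h' fun i => by rw [hget i])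
  simp only [List.length_map] at hlen
  refine List.ext_getElem hlen fun i hi hi' => ?_
  have := hget i
  rwa [List.getD_eq_getElem _ _ hi, List.getD_eq_getElem _ _ hi'] at this

/-- Singles out the row containing `a`, which is where the truncated shape gains its box when the
bound reaches `a`. -/
theorem exists_count_row_eq {T : List (List ℕ)} {a : ℕ} (hT : (readingWord T).Nodup)
    (ha : a ∈ readingWord T) : ∃ r, ∀ i, (T.getD i []).count a = if i = r then 1 else 0 := by
  induction T with
  | nil => simp [readingWord] at ha
  | cons R T ih =>
    simp only [readingWord, List.nodup_append] at hT
    simp only [readingWord, List.mem_append] at ha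
    by_cases haT : a ∈ readingWord T
    · obtain ⟨r, hr⟩ := ih hT.1 haT
      refine ⟨r + 1, fun i => ?_⟩
      cases i with
      | zero => simpa [List.count_eq_zero] using fun h => hT.2.2 a haT a h rfl
      | succ i => simpa using hr i
    · refine ⟨0, fun i => ?_⟩
      cases i with
      | zero => simpa using List.count_eq_one_of_mem hT.2.1 (ha.resolve_left haT)
      | succ i =>
        simp only [List.getD_cons_succ, Nat.add_eq_zero_iff, one_ne_zero, and_false, if_false,
          List.count_eq_zero]
        intro h
        rw [List.getD_eq_getElem?_getD] at h
        cases hi : T[i]? with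
        | none => simp [hi] at h
        | some S =>
          rw [hi] at h
          exact haT (mem_readingWord.2 ⟨S, List.mem_of_getElem? hi, h⟩)

theorem List.length_filter_le_succ (R : List ℕ) (k : ℕ) :
    (R.filter (· ≤ k + 1)).length = (R.filter (· ≤ k)).length + R.count (k + 1) := by
  induction R with
  | nil => rfl
  | cons a R ih =>
    simp only [List.filter_cons, List.count_cons, decide_eq_true_eq, beq_iff_eq]
    split_ifs <;> (try simp only [List.length_cons]) <;> omega

theorem IsRowTableau.isGrowth {T : List (List ℕ)} (h : IsRowTableau T) {n : ℕ}
    (hnd : (readingWord T).Nodup) (hmem : ∀ a, a ∈ readingWord T ↔ 1 ≤ a ∧ a ≤ n) :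
    IsGrowth n fun k i => ((T.getD i []).filter (· ≤ k)).length := by
  refine ⟨fun i => ?_, fun k _ => ?_, fun k hk => ?_⟩
  · rw [List.length_eq_zero_iff, List.filter_eq_nil_iff]
    intro a ha h0
    rw [List.getD_eq_getElem?_getD] at ha
    cases hi : T[i]? with
    | none => simp [hi] at ha
    | some S =>
      rw [hi] at ha
      have := (hmem a).1 (mem_readingWord.2 ⟨S, List.mem_of_getElem? hi, ha⟩)
      simp at h0
      omega
  · refine cast (congrArg Antitone (funext fun i => ?_))
      (h.columnStrict_filter_le k).antitone_length
    simp only [List.getD_eq_getElem?_getD, List.getElem?_map]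
    cases T[i]? <;> simp
  · obtain ⟨r, hr⟩ := exists_count_row_eq hnd ((hmem (k + 1)).2 ⟨by omega, by omega⟩)
    exact ⟨r, fun i => by rw [List.length_filter_le_succ, hr]⟩

/-! ### Existence of the pair of tableaux -/

theorem InsertionTableau.greeneRow_position {n : ℕ} {σ : Equiv.Perm (Fin n)} {k : ℕ}
    {T : List (List ℕ)} (h : InsertionTableau ((permWord σ).take k) T) (i : ℕ) :
    greeneRow ((linearExtensionByPosition σ).firstElements k) i = (T.getD i []).length :=
  _root_.greeneRow_position σ h.isRowTableau h.knuthEquiv i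

theorem exists_insertionTableau_take {n : ℕ} (σ : Equiv.Perm (Fin n)) (k : ℕ) :
    ∃ T, InsertionTableau ((permWord σ).take k) T :=
  InsertionTableau.exists_of_nodup ((nodup_permWord σ).sublist (List.take_sublist _ _))

theorem isGrowth_position {n : ℕ} (σ : Equiv.Perm (Fin n)) :
    IsGrowth n fun k => greeneRow ((linearExtensionByPosition σ).firstElements k) := by
  refine ⟨fun i => ?_, fun k _ => ?_, fun k hk => ?_⟩
  · rw [InsertionTableau.greeneRow_position (T := []) (by simpa using .nil)]
    simp
  · obtain ⟨T, hT⟩ := exists_insertionTableau_take σ k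
    rw [show greeneRow _ = _ from funext hT.greeneRow_position]
    exact hT.isRowTableau.col.antitone_length
  · obtain ⟨U, hU⟩ := exists_insertionTableau_take σ (k + 1)
    have hU' := hU
    rw [List.take_succ_eq_append_getElem (by simpa using hk)] at hU'
    obtain ⟨T, hT, hTU⟩ := hU'.inv_snoc
    obtain ⟨r, hr⟩ := hTU.length_row
    exact ⟨r, fun i => by rw [hU.greeneRow_position, hT.greeneRow_position, hr]⟩

theorem exists_isRobinsonSchenstedPair {n : ℕ} (σ : Equiv.Perm (Fin n)) :
    ∃ T, IsRobinsonSchenstedPair σ T := by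
  obtain ⟨T, hT⟩ := InsertionTableau.exists_of_nodup (nodup_permWord σ)
  have hp := hT.knuthEquiv.perm
  have hmem : ∀ a, a ∈ readingWord T ↔ 1 ≤ a ∧ a ≤ n := fun a => by
    rw [← hp.mem_iff, mem_permWord]
  have hP := hT.isRowTableau.isGrowth (hp.nodup_iff.1 (nodup_permWord σ)) hmem
  have hQ := isGrowth_position σ
  -- At the bound `n` nothing is truncated and the prefix is the whole word, so both growths end in
  -- the shape of `T`.
  have hPQ : ∀ i, ((T.getD i []).filter (· ≤ n)).length =
      greeneRow ((linearExtensionByPosition σ).firstElements n) i := by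
    intro i
    rw [InsertionTableau.greeneRow_position (T := T)
      (by rwa [List.take_of_length_le (by simp)]), List.filter_eq_self.2]
    intro a ha
    rw [List.getD_eq_getElem?_getD] at ha
    cases hi : T[i]? with
    | none => simp [hi] at ha
    | some S =>
      rw [hi] at ha
      simpa using ((hmem a).1 (mem_readingWord.2 ⟨S, List.mem_of_getElem? hi, ha⟩)).2
  obtain ⟨μ, hμ⟩ := exists_youngDiagram (hP.antitone n le_rfl) (N := T.length) (by simp)
  obtain ⟨hcard, P, hP'⟩ := hP.exists_standardYoungTableau hμ
  obtain ⟨-, Q, hQ'⟩ := hQ.exists_standardYoungTableau (μ := μ) fun i j => by rw [hμ, hPQ]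
  refine ⟨⟨μ, hcard, P, Q⟩, (isTableauOfLinearExtension_iff hcard).2 fun k hk i j => ?_,
    (isTableauOfLinearExtension_iff hcard).2 hQ'⟩
  rw [greeneRow_value σ hT.isRowTableau hT.knuthEquiv]
  exact hP' k hk i j

/-! ### Injectivity and surjectivity by reversing insertions -/

theorem InsertionTableau.word_injective {w w' : List ℕ} {T : List (List ℕ)}
    (h : InsertionTableau w T) (h' : InsertionTableau w' T) (hlen : w.length = w'.length)
    (hs : ∀ k S S', InsertionTableau (w.take k) S → InsertionTableau (w'.take k) S' →
      S.map List.length = S'.map List.length) : w = w' := by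
  induction h generalizing w' with
  | nil => simpa [eq_comm] using hlen
  | @snoc w a T U hT h ih =>
    rcases List.eq_nil_or_concat w' with rfl | ⟨v, b, rfl⟩
    · simp at hlen
    · rw [List.concat_eq_append] at *
      have hlen' : w.length = v.length := by simpa using hlen
      obtain ⟨S, hS, hSU⟩ := h'.inv_snoc
      have h1 := hs w.length T S (by simpa using hT) (by simpa [hlen'] using hS)
      -- Equal shapes before the last insertion make that insertion undoable in one way only, so the
      -- last letters and the earlier tableaux agree.
      obtain ⟨rfl, rfl⟩ := h.injective hSU h1 hT.isRowTableau.row_lt hS.isRowTableau.row_lt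
      rw [ih hS hlen' fun k X X' hX hX' => ?_]
      -- The minimum keeps the prefix of the longer word from reaching the last letter.
      refine hs (min k w.length) X X' ?_ ?_
      · rwa [List.take_append_of_le_length (by omega), ← List.take_take, List.take_length]
      · rwa [List.take_append_of_le_length (by omega), hlen', ← List.take_take, List.take_length]

theorem IsRobinsonSchenstedPair.injective {n : ℕ} {σ τ : Equiv.Perm (Fin n)}
    {T : StandardYoungTableauPair n} (hσ : IsRobinsonSchenstedPair σ T)
    (hτ : IsRobinsonSchenstedPair τ T) : σ = τ := by
  obtain ⟨S, hS⟩ := InsertionTableau.exists_of_nodup (nodup_permWord σ)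
  obtain ⟨S', hS'⟩ := InsertionTableau.exists_of_nodup (nodup_permWord τ)
  -- The value data give the lengths of all truncated rows, hence the common insertion tableau; the
  -- position data give the prefix shapes used below.
  obtain rfl : S = S' := by
    refine hS.isRowTableau.eq_of_length_filter_le_eq hS'.isRowTableau fun k i => ?_
    rw [← greeneRow_value σ hS.isRowTableau hS.knuthEquiv,
      ← greeneRow_value τ hS'.isRowTableau hS'.knuthEquiv, hσ.1.greeneRow_eq hτ.1]
  refine permWord_injective (hS.word_injective hS' (by simp) fun k X X' hX hX' => ?_)
  refine hX.isRowTableau.map_length_eq hX'.isRowTableau fun i => ?_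
  rw [← hX.greeneRow_position, ← hX'.greeneRow_position, hσ.2.greeneRow_eq hτ.2]

/-- The word is built from its last letter backwards, by reverse insertion at the box in which
consecutive shapes differ. -/
theorem IsGrowth.exists_insertionTableau {n : ℕ} {l : ℕ → ℕ → ℕ} (hl : IsGrowth n l)
    {T : List (List ℕ)} (hT : IsRowTableau T) (hnd : (readingWord T).Nodup)
    (hTl : ∀ i, (T.getD i []).length = l n i) :
    ∃ w : List ℕ, w.length = n ∧ InsertionTableau w T ∧
      ∀ k ≤ n, ∃ S, InsertionTableau (w.take k) S ∧ ∀ i, (S.getD i []).length = l k i := by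
  induction n generalizing T with
  | zero =>
    have hT' : T = [] := by
      cases T with
      | nil => rfl
      | cons R T =>
        have := hTl 0
        rw [hl.zero] at this
        exact absurd (by simpa using this) (hT.ne_nil R (by simp))
    subst hT'
    exact ⟨[], rfl, .nil, fun k hk => ⟨[], by simpa using .nil, by
      obtain rfl : k = 0 := by omega
      exact hTl⟩⟩
  | succ n ih =>
    obtain ⟨r, hr⟩ := hl.step n (by omega)
    -- The added box is a corner because the previous shape `l n` was already a partition.
    have hcorner : (T.getD (r + 1) []).length < (T.getD r []).length := by
      have := hl.antitone n (by omega) (Nat.le_succ r)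
      rw [hTl, hTl, hr, hr]
      simp
      exact this
    obtain ⟨S, a, hST, hS, hlen⟩ := RowInsertion.exists_of_corner hT hnd hcorner
    have hnd' : (readingWord S ++ [a]).Nodup :=
      (hST.knuthEquiv hS.row_lt).perm.nodup_iff.2 hnd
    obtain ⟨w, hw, hwS, hpre⟩ := ih (hl.of_le (Nat.le_succ n)) hS (List.nodup_append.1 hnd').1
      fun i => by
        have h1 := hlen i
        have h2 := hr i
        rw [hTl] at h1
        omega
    refine ⟨w ++ [a], by simp [hw], hwS.snoc hST, fun k hk => ?_⟩
    rcases Nat.lt_or_ge n k with hk' | hk'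
    · obtain rfl : k = n + 1 := by omega
      exact ⟨T, by rw [List.take_of_length_le (by simp [hw])]; exact hwS.snoc hST, hTl⟩
    · rw [List.take_append_of_le_length (by omega)]
      exact hpre k hk'

/-! ## Standard Young tableaux as lists of rows -/

namespace StandardYoungTableau

variable {μ : YoungDiagram} (P : StandardYoungTableau μ)

/-- Row `i` of a standard Young tableau. -/
def rowList (i : ℕ) : List ℕ := (List.range (μ.rowLen i)).map (P.entry i)

/-- The rows of a standard Young tableau. -/
def rowLists : List (List ℕ) := (List.range (μ.colLen 0)).map P.rowList

theorem rowLen_eq_zero {i : ℕ} (h : μ.colLen 0 ≤ i) : μ.rowLen i = 0 := by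
  by_contra h0
  have h1 : (i, 0) ∈ μ := YoungDiagram.mem_iff_lt_rowLen.2 (Nat.pos_of_ne_zero h0)
  have := YoungDiagram.mem_iff_lt_colLen.1 h1
  omega

theorem rowLists_getD (i : ℕ) : P.rowLists.getD i [] = P.rowList i := by
  rw [List.getD_eq_getElem?_getD, rowLists, List.getElem?_map]
  rcases lt_or_ge i (μ.colLen 0) with h | h
  · simp [h]
  · simp [h, rowList, rowLen_eq_zero h]

theorem pairwise_rowList (i : ℕ) : (P.rowList i).Pairwise (· < ·) := by
  rw [rowList, List.pairwise_map]
  refine List.pairwise_lt_range.imp_of_mem ?_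
  intro j1 j2 h1 h2 hj
  rw [List.mem_range, ← YoungDiagram.mem_iff_lt_rowLen] at h1 h2
  refine lt_of_le_of_ne (P.row_weak' hj h2) fun h => ?_
  have := P.bijOn'.injOn (show (i, j1) ∈ {c | c ∈ μ} from h1) (show (i, j2) ∈ {c | c ∈ μ} from h2) h
  simp at this
  omega

theorem mem_rowList {i a : ℕ} : a ∈ P.rowList i ↔ ∃ j, (i, j) ∈ μ ∧ P.entry i j = a := by
  simp [rowList, YoungDiagram.mem_iff_lt_rowLen]

theorem mem_readingWord_rowLists {a : ℕ} :
    a ∈ readingWord P.rowLists ↔ 1 ≤ a ∧ a ≤ μ.card := by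
  rw [mem_readingWord]
  constructor
  · rintro ⟨R, hR, ha⟩
    obtain ⟨i, -, rfl⟩ := List.mem_map.1 hR
    obtain ⟨j, hj, rfl⟩ := P.mem_rowList.1 ha
    exact P.entry_mem_Icc hj
  · intro ha
    obtain ⟨⟨i, j⟩, hij, rfl⟩ := P.bijOn'.surjOn ha
    refine ⟨P.rowList i, List.mem_map_of_mem ?_, P.mem_rowList.2 ⟨j, hij, rfl⟩⟩
    rw [List.mem_range, ← YoungDiagram.mem_iff_lt_colLen]
    exact μ.up_left_mem le_rfl (Nat.zero_le j) hij

theorem _root_.readingWord_perm_flatten {α : Type*} (T : List (List α)) :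
    (readingWord T).Perm T.flatten := by
  induction T with
  | nil => exact .refl _
  | cons R T ih => exact (ih.append_right R).trans List.perm_append_comm

theorem nodup_readingWord_rowLists : (readingWord P.rowLists).Nodup := by
  rw [(readingWord_perm_flatten _).nodup_iff, List.nodup_flatten]
  constructor
  · rintro R hR
    obtain ⟨i, -, rfl⟩ := List.mem_map.1 hR
    exact (P.pairwise_rowList i).imp fun h => h.ne
  · rw [rowLists, List.pairwise_map]
    refine List.pairwise_lt_range.imp ?_
    intro i i' hi a ha ha'
    obtain ⟨j, hj, rfl⟩ := P.mem_rowList.1 ha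
    obtain ⟨j', hj', h⟩ := P.mem_rowList.1 ha'
    have := P.bijOn'.injOn (show (i', j') ∈ {c | c ∈ μ} from hj')
      (show (i, j) ∈ {c | c ∈ μ} from hj) h
    simp at this
    omega

theorem _root_.rowBelow_of_getElem {α : Type*} {r : α → α → Prop} {R S : List α}
    (hl : S.length ≤ R.length) (h : ∀ (j : ℕ) (hj : j < S.length), r R[j] S[j]) :
    RowBelow r R S := by
  induction S generalizing R with
  | nil => simp
  | cons b S ih => cases R with
    | nil => simp at hl
    | cons a R =>
      refine ⟨h 0 (by simp), ih (by simpa using hl) fun j hj => ?_⟩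
      exact h (j + 1) (by simpa using hj)

theorem _root_.columnStrict_of_getD {α : Type*} {r : α → α → Prop} {T : List (List α)}
    (h : ∀ i, RowBelow r (T.getD i []) (T.getD (i + 1) [])) : ColumnStrict r T := by
  induction T with
  | nil => trivial
  | cons R T ih =>
    refine ⟨?_, ih fun i => by simpa using h (i + 1)⟩
    cases T with
    | nil => simp
    | cons S T => simpa using h 0

theorem isRowTableau_rowLists : IsRowTableau P.rowLists := by
  refine ⟨fun R hR => ?_, columnStrict_of_getD fun i => ?_, fun R hR => ?_⟩
  · obtain ⟨i, -, rfl⟩ := List.mem_map.1 hR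
    exact P.pairwise_rowList i
  · rw [rowLists_getD, rowLists_getD]
    refine rowBelow_of_getElem (by simpa [rowList] using μ.rowLen_anti _ _ (Nat.le_succ i)) ?_
    intro j hj
    have hj' : (i + 1, j) ∈ μ := YoungDiagram.mem_iff_lt_rowLen.2 (by simpa [rowList] using hj)
    simpa [rowList] using P.col_strict' (Nat.lt_succ_self i) hj'
  · obtain ⟨i, hi, rfl⟩ := List.mem_map.1 hR
    rw [List.mem_range, ← YoungDiagram.mem_iff_lt_colLen, YoungDiagram.mem_iff_lt_rowLen] at hi
    rw [← List.length_pos_iff]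
    simpa [rowList] using hi

theorem mem_and_entry_le_iff (k i j : ℕ) : ((i, j) ∈ μ ∧ P.entry i j ≤ k) ↔
    j < ((P.rowLists.getD i []).filter (· ≤ k)).length := by
  rw [rowLists_getD, List.lt_length_filter_le_iff (P.pairwise_rowList i)]
  simp [rowList, YoungDiagram.mem_iff_lt_rowLen]

theorem isGrowth_rowLists {n : ℕ} (hμ : μ.card = n) :
    IsGrowth n fun k i => ((P.rowLists.getD i []).filter (· ≤ k)).length :=
  P.isRowTableau_rowLists.isGrowth P.nodup_readingWord_rowLists fun _ =>
    hμ ▸ P.mem_readingWord_rowLists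

end StandardYoungTableau

theorem exists_perm_isRobinsonSchenstedPair {n : ℕ} (T : StandardYoungTableauPair n) :
    ∃ σ : Equiv.Perm (Fin n), IsRobinsonSchenstedPair σ T := by
  obtain ⟨μ, hμ, P, Q⟩ := T
  have hPQ : ∀ i, (P.rowLists.getD i []).length =
      ((Q.rowLists.getD i []).filter (· ≤ n)).length := by
    intro i
    rw [List.filter_eq_self.2, P.rowLists_getD, Q.rowLists_getD]
    · simp [StandardYoungTableau.rowList]
    · intro a ha
      rw [Q.rowLists_getD] at ha
      obtain ⟨j, hj, rfl⟩ := Q.mem_rowList.1 ha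
      simpa [← hμ] using (Q.entry_mem_Icc hj).2
  -- Reverse insertion starts from the rows of `P` and removes corners in the order dictated by `Q`.
  -- Knuth moves permute letters, so the resulting word is that of a permutation.
  obtain ⟨w, hw, hwP, hpre⟩ := (Q.isGrowth_rowLists hμ).exists_insertionTableau
    P.isRowTableau_rowLists P.nodup_readingWord_rowLists hPQ
  have hp := hwP.knuthEquiv.perm
  obtain ⟨σ, rfl⟩ := exists_permWord_eq hw (hp.nodup_iff.2 P.nodup_readingWord_rowLists)
    fun a ha => by
      have := P.mem_readingWord_rowLists.1 (hp.mem_iff.1 ha)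
      omega
  refine ⟨σ, (isTableauOfLinearExtension_iff hμ).2 fun k hk i j => ?_,
    (isTableauOfLinearExtension_iff hμ).2 fun k hk i j => ?_⟩
  · rw [greeneRow_value σ hwP.isRowTableau hwP.knuthEquiv]
    exact P.mem_and_entry_le_iff k i j
  · obtain ⟨S, hS, hSl⟩ := hpre k hk
    rw [hS.greeneRow_position, hSl]
    exact Q.mem_and_entry_le_iff k i j

/-- The conditions defining `P(σ)` and `Q(σ)` determine a map `RS : σ ↦ (P(σ), Q(σ))` into the pairs
of standard Young tableaux of the same shape with `n` boxes, and this map is a bijection. -/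
theorem corollary3p4 (n : ℕ) :
    ∃ RS : Equiv.Perm (Fin n) → StandardYoungTableauPair n,
      (∀ (σ : Equiv.Perm (Fin n)) (T : StandardYoungTableauPair n),
        RS σ = T ↔ IsRobinsonSchenstedPair σ T) ∧
      Function.Bijective RS := by
  choose RS hRS using fun σ : Equiv.Perm (Fin n) => exists_isRobinsonSchenstedPair σ
  have hiff : ∀ (σ : Equiv.Perm (Fin n)) (T : StandardYoungTableauPair n),
      RS σ = T ↔ IsRobinsonSchenstedPair σ T := fun σ T =>
    ⟨fun h => h ▸ hRS σ, fun h => (hRS σ).unique h⟩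
  refine ⟨RS, hiff, fun σ τ h => (hRS σ).injective (h ▸ hRS τ), fun T => ?_⟩
  obtain ⟨σ, hσ⟩ := exists_perm_isRobinsonSchenstedPair T
  exact ⟨σ, (hiff σ T).2 hσ⟩
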